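/- For $a,b\in\mathbb C$ consider the equation $\psi''(\lambda)=(4\lambda^3-a\lambda-b)\,\psi(\lambda)$ on $\mathbb C$; all indices $k$ below belong to $\mathbb Z_5=\mathbb Z/5\mathbb Z$. For a basis $\{\varphi,\chi\}$ of (entire) solutions, the $k$-th asymptotic value is the limit in $\mathbb C\cup\{\infty\}$ $$w_k(\varphi,\chi)=\lim_{\lambda\to\infty,\ |\arg\lambda-\frac{2\pi k}{5}|<\frac{\pi}{5}-\varepsilon}\frac{\varphi(\lambda)}{\chi(\lambda)}\qquad(\text{for every }\varepsilon>0).$$ For $z=(z_k)_{k\in\mathbb Z_5}$ with $z_k\in\mathbb C\cup\{\infty\}$ and $z_k\neq z_{k+1}$ for all $k$, put $R_k(z)=(z_{1+k},z_{-2+k};z_{-1+k},z_{2+k})\in\mathbb C$, where $(p,q;r,s)=\frac{(p-r)(q-s)}{(p-s)(q-r)}$ is the cross ratio, and define $R_k(a,b)=R_k\big((w_j(\varphi,\chi))_{j\in\mathbb Z_5}\big)$ for a basis $\{\varphi,\chi\}$ of solutions of the equation with parameters $a,b$. This is well defined: bases of solutions exist, and for every basis of solutions the five limits exist, satisfy $w_k\ne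 w_{k+1}$, and $R_k(a,b)$ does not depend on the choice of the basis. Let $\omega=e^{2\pi i/5}$. Then for all $k\in\mathbb Z_5$ and $a,b\in\mathbb C$: 1. (Symmetry) $R_k(\omega^{-1}a,\omega b)=R_{k-2}(a,b)$. 2. (Sibuya's equation) $R_k(\omega^{-1}a,\omega b)\,R_k(\omega a,\omega^{-1}b)=1-R_k(a,b)$. 3. (Deformed Y-system) For fixed $a\in\mathbb C$, the functions $Y_k(\theta)=-R_0(\omega^{-k}a,e^{6\theta/5})$ satisfy $Y_{k-1}(\theta-\tfrac{i\pi}{3})\,Y_{k+1}(\theta+\tfrac{i\pi}{3})=1+Y_k(\theta)$ for all $k\in\mathbb Z_5$ and $\theta\in\mathbb C$. 4. (Equivalence of 2 and 3) Let $F_k:\mathbb C^2\to\mathbb C$, $k\in\mathbb Z_5$, be any functions with $F_k(\omega^{-1}a,\omega b)=F_{k-2}(a,b)$ for all $k,a,b$, and let $a\in\mathbb C$. Then the equations $F_k(\omega^{-1}a,\omega b)F_k(\omega a,\omega^{-1}b)=1-F_k(a,b)$ hold for all $k$ and all $b\neq0$ if and only if the functions $-F_0(\omega^{-k}a,e^{6\theta/5})$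 satisfy the deformed Y-system of 3. If moreover $b\mapsto F_k(c,b)$ is continuous at $b=0$ for all $k$ and all $c\in\mathbb C$, then the deformed Y-system is equivalent to these equations for all $k$ and all $b\in\mathbb C$, including $b=0$. -/

import Mathlib

open Filter Topology

noncomputable section

namespace CubicOscillator

/-- The cubic potential `V(x; a, b) = 4 x ^ 3 - a x - b`. -/
def potential (a b x : ℂ) : ℂ := 4 * x ^ 3 - a * x - b

/-- Entire solutions of `ψ'' = V(x; a, b) ψ`. -/
def IsSolution (a b : ℂ) (ψ : ℂ → ℂ) : Prop :=
  Differentiable ℂ ψ ∧ ∀ x, deriv (deriv ψ) x = potential a b x * ψ x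

/-- Two linearly independent solutions, that is, a basis of the two-dimensional solution space. -/
def IsSolutionBasis (a b : ℂ) (φ χ : ℂ → ℂ) : Prop :=
  IsSolution a b φ ∧ IsSolution a b χ ∧ LinearIndependent ℂ ![φ, χ]

/-- The primitive fifth root of unity `ω = exp (2 π i / 5)`. -/
def ω : ℂ := Complex.exp (2 * Real.pi * Complex.I / 5)

/-- The proper subsector `|arg x - 2 π k / 5| < π / 5 - ε` (for a suitable branch of the argument).
It is obtained from the sector around the positive axis through the rotation by `ω ^ k`. -/
def sector (k : ZMod 5) (ε : ℝ) : Set ℂ :=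
  {x | |Complex.arg (x / ω ^ k.val)| < Real.pi / 5 - ε}

/-- The quotient `u / v` as a point of the Riemann sphere `ℂ ∪ {∞}`, with `u / 0 = ∞`. -/
def sphereQuot (u v : ℂ) : OnePoint ℂ :=
  if v = 0 then OnePoint.infty else ((u / v : ℂ) : OnePoint ℂ)

/-- `w` is the `k`-th asymptotic value of the pair `φ, χ`: the limit of `φ / χ` in the Riemann
sphere at infinity, in all proper subsectors of the `k`-th Stokes sector. -/
def IsAsymptoticValue (φ χ : ℂ → ℂ) (k : ZMod 5) (w : OnePoint ℂ) : Prop :=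
  ∀ ε : ℝ, 0 < ε →
    Tendsto (fun x => sphereQuot (φ x) (χ x)) (Bornology.cobounded ℂ ⊓ 𝓟 (sector k ε)) (𝓝 w)

/-- Quintuples of points of the Riemann sphere whose cyclically neighbouring entries differ. -/
def W5 : Set (ZMod 5 → OnePoint ℂ) := {z | ∀ k, z k ≠ z (k + 1)}

/-- Homogeneous coordinates of a point of the Riemann sphere. -/
def homog : OnePoint ℂ → ℂ × ℂ
  | OnePoint.infty => (1, 0)
  | OnePoint.some z => (z, 1)

/-- The determinant of homogeneous coordinates; it is `z - w` at finite points `z, w`. -/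
def bracket (z w : OnePoint ℂ) : ℂ := (homog z).1 * (homog w).2 - (homog w).1 * (homog z).2

/-- The cross ratio `(p, q; r, s) = (p - r) (q - s) / ((p - s) (q - r))` on the Riemann sphere. -/
def crossRatio (p q r s : OnePoint ℂ) : ℂ :=
  (bracket p r * bracket q s) / (bracket p s * bracket q r)

theorem crossRatio_coe (p q r s : ℂ) :
    crossRatio (p : OnePoint ℂ) q r s = ((p - r) * (q - s)) / ((p - s) * (q - r)) := by
  simp [crossRatio, bracket, homog]

/-- `R_k (z) = (z_{1+k}, z_{-2+k}; z_{-1+k}, z_{2+k})`. -/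
def Rpoint (k : ZMod 5) (z : ZMod 5 → OnePoint ℂ) : ℂ :=
  crossRatio (z (1 + k)) (z (-2 + k)) (z (-1 + k)) (z (2 + k))

/-- `z` is the quintuple of asymptotic values of some basis of solutions, that is, a representative
of the monodromy data of the equation with parameters `a, b`. -/
def IsMonodromyPoint (a b : ℂ) (z : ZMod 5 → OnePoint ℂ) : Prop :=
  ∃ φ χ : ℂ → ℂ, IsSolutionBasis a b φ χ ∧ ∀ k, IsAsymptoticValue φ χ k (z k)

/-- A representative of the monodromy data of the equation with parameters `a, b`. -/
def monodromyPoint (a b : ℂ) : ZMod 5 → OnePoint ℂ := Classical.epsilon (IsMonodromyPoint a b)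

/-- `R_k (a, b)`: the value of `R_k` at the monodromy data of the equation with parameters `a, b`. -/
def R (k : ZMod 5) (a b : ℂ) : ℂ := Rpoint k (monodromyPoint a b)

/-- The relation `F_k (ω⁻¹ a, ω b) = F_{k-2} (a, b)`. -/
def RotationSymmetric (F : ZMod 5 → ℂ → ℂ → ℂ) : Prop :=
  ∀ k a b, F k (ω⁻¹ * a) (ω * b) = F (k - 2) a b

/-- Sibuya's equation for `F_k` at the point `(a, b)`. -/
def SibuyaEq (F : ZMod 5 → ℂ → ℂ → ℂ) (k : ZMod 5) (a b : ℂ) : Prop :=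
  F k (ω⁻¹ * a) (ω * b) * F k (ω * a) (ω⁻¹ * b) = 1 - F k a b

/-- `Y_k (θ) = - F_0 (ω ^ (-k) a, exp (6 θ / 5))`, for a fixed `a`. -/
def Y (F : ZMod 5 → ℂ → ℂ → ℂ) (a : ℂ) (k : ZMod 5) (θ : ℂ) : ℂ :=
  -F 0 ((ω ^ k.val)⁻¹ * a) (Complex.exp (6 / 5 * θ))

/-- The deformed Y-system, for a fixed `a`. -/
def DeformedYSystem (F : ZMod 5 → ℂ → ℂ → ℂ) (a : ℂ) : Prop :=
  ∀ (k : ZMod 5) (θ : ℂ),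
    Y F a (k - 1) (θ - Complex.I * Real.pi / 3) * Y F a (k + 1) (θ + Complex.I * Real.pi / 3)
      = 1 + Y F a k θ

end CubicOscillator

end

/-!
All statements reduce to facts about recessive solutions. For each sector `k` there is, up to a
factor, one solution `ψ k` that is negligible there against all solutions not proportional to it
(`exists_isRecessive`). Any three solutions satisfy a linear relation whose coefficients are their
Wronskians (`wr_mul_apply`), so the `k`-th asymptotic value of a basis `φ, χ` is the point with
homogeneous coordinates `wr (ψ k) φ : wr (ψ k) χ` (`IsRecessive.isAsymptoticValue`). Hence the
brackets of the asymptotic values are, up to the choice of coordinates, the Wronskians of the `ψ k`,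
and the cross ratios do not depend on the basis (`Rpoint_asymptoticPoint`). The symmetry comes from
the rotation `x ↦ ω ^ 3 x`, under which the potential is quasi-homogeneous (`R_rotationSymmetric`).
Given the symmetry, Sibuya's equation is the Plücker relation (`crossRatio_mul_crossRatio`), and the
Y-system is a reparametrization of Sibuya's equation by `b = exp (6 θ / 5)`.

For the existence of recessive solutions, substitute `x = t ^ 2`. The combinations
`ψ' (t ^ 2) ± 2 t ^ 3 ψ (t ^ 2)` satisfy a first order system that is diagonal with entries
`± 4 t ^ 4` up to bounded terms. Along lines on which `t ^ 5` has increasing real part, the cone in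
which the first combination dominates is invariant, and solutions in it grow
(`IsSolution.amp_growth`). Lines that start at one point far out on the positive axis cover a proper
subsector up to a bounded set, so some solution `D` grows in the whole subsector
(`exists_growing`). Since `(φ / D)' = wr D φ / D ^ 2`, all quotients `φ / D` converge there, and
subtracting from `φ` the right multiple of `D` gives the recessive solution.

Neighbouring asymptotic values differ because no solution is recessive in two neighbouring sectors
(`IsRecessive.not_isRecessive_add_one`). On each ray of its sector a recessive solution decays like
`exp (- c |x| ^ (5 / 2))`, since otherwise it would be in the invariant cone and grow. If `ψ` were
recessive in two neighbouring sectors, then `z ↦ ψ (ζ z ^ (1 / 2))`, for a suitable `ζ` of modulus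
one, would be a function of order `5 / 4` in the right half plane that is bounded on the imaginary
axis and superexponentially small on the positive axis. By the Phragmén–Lindelöf principle it
vanishes.
-/

namespace CubicOscillator

/-! ### Solutions and Wronskians -/

theorem IsSolution.hasDerivAt {a b : ℂ} {ψ : ℂ → ℂ} (h : IsSolution a b ψ) (x : ℂ) :
    HasDerivAt ψ (deriv ψ x) x :=
  (h.1 x).hasDerivAt

theorem IsSolution.hasDerivAt_deriv {a b : ℂ} {ψ : ℂ → ℂ} (h : IsSolution a b ψ) (x : ℂ) :
    HasDerivAt (deriv ψ) (potential a b x * ψ x) x :=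
  h.2 x ▸ ((h.1.contDiff (n := 2)).differentiable_deriv_two x).hasDerivAt

theorem isSolution_of_hasDerivAt {a b : ℂ} {ψ ψ' : ℂ → ℂ} (h : ∀ x, HasDerivAt ψ (ψ' x) x)
    (h' : ∀ x, HasDerivAt ψ' (potential a b x * ψ x) x) : IsSolution a b ψ := by
  have hd : deriv ψ = ψ' := funext fun x => (h x).deriv
  exact ⟨fun x => (h x).differentiableAt, fun x => by rw [hd, (h' x).deriv]⟩

theorem IsSolution.lincomb {a b : ℂ} {φ χ : ℂ → ℂ} (hφ : IsSolution a b φ)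
    (hχ : IsSolution a b χ) (α β : ℂ) : IsSolution a b (fun x => α * φ x + β * χ x) := by
  refine isSolution_of_hasDerivAt (ψ' := fun x => α * deriv φ x + β * deriv χ x)
    (fun x => ((hφ.hasDerivAt x).const_mul α).add ((hχ.hasDerivAt x).const_mul β)) fun x => ?_
  exact (((hφ.hasDerivAt_deriv x).const_mul α).add
    ((hχ.hasDerivAt_deriv x).const_mul β)).congr_deriv (by ring)

/-- The Wronskian `φ χ' - φ' χ`, evaluated at `0`; for two solutions of the same equation it is
constant, see `wr_eq`. -/
noncomputable def wr (φ χ : ℂ → ℂ) : ℂ := φ 0 * deriv χ 0 - deriv φ 0 * χ 0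

theorem wr_swap (φ χ : ℂ → ℂ) : wr χ φ = -wr φ χ := by
  unfold wr; ring

theorem wr_eq {a b : ℂ} {φ χ : ℂ → ℂ} (hφ : IsSolution a b φ) (hχ : IsSolution a b χ) (x : ℂ) :
    φ x * deriv χ x - deriv φ x * χ x = wr φ χ := by
  have h : ∀ x, HasDerivAt (fun x => φ x * deriv χ x - deriv φ x * χ x) 0 x := fun x =>
    (((hφ.hasDerivAt x).mul (hχ.hasDerivAt_deriv x)).sub
      ((hφ.hasDerivAt_deriv x).mul (hχ.hasDerivAt x))).congr_deriv (by ring)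
  exact is_const_of_deriv_eq_zero (fun x => (h x).differentiableAt) (fun x => (h x).deriv) x 0

/-- Three solutions of the same equation satisfy a linear relation whose coefficients are their
Wronskians. -/
theorem wr_mul_apply {a b : ℂ} {φ χ ψ : ℂ → ℂ} (hφ : IsSolution a b φ) (hχ : IsSolution a b χ)
    (hψ : IsSolution a b ψ) (x : ℂ) : wr ψ χ * φ x = wr φ χ * ψ x + wr ψ φ * χ x := by
  rw [← wr_eq hψ hχ x, ← wr_eq hφ hχ x, ← wr_eq hψ hφ x]
  ring

theorem IsSolution.eq_zero {a b : ℂ} {φ χ ψ : ℂ → ℂ} (hφ : IsSolution a b φ)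
    (hχ : IsSolution a b χ) (hψ : IsSolution a b ψ) (h : wr ψ χ ≠ 0) (h₁ : wr φ χ = 0)
    (h₂ : wr ψ φ = 0) : φ = 0 := by
  funext x
  have := wr_mul_apply hφ hχ hψ x
  simpa [h₁, h₂, h] using this

theorem deriv_lincomb {a b : ℂ} {φ χ : ℂ → ℂ} (hφ : IsSolution a b φ) (hχ : IsSolution a b χ)
    (α β x : ℂ) : deriv (fun x => α * φ x + β * χ x) x = α * deriv φ x + β * deriv χ x :=
  (((hφ.hasDerivAt x).const_mul α).add ((hχ.hasDerivAt x).const_mul β)).deriv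

/-! ### Existence of solutions -/

/-- Taylor coefficients at `0` of the solution with initial values `u, v`. -/
noncomputable def coeff (a b u v : ℂ) : ℕ → ℂ
  | 0 => u
  | 1 => v
  | 2 => -b * u / 2
  | 3 => (-a * u - b * v) / 6
  | 4 => (-a * v - b * coeff a b u v 2) / 12
  | n + 5 => (4 * coeff a b u v n - a * coeff a b u v (n + 2) - b * coeff a b u v (n + 3)) /
      ((n + 4) * (n + 5))

/-- The Taylor coefficients decay faster than every geometric sequence: for large `n` the factor
`1 / ((n + 4) (n + 5))` of the recursion beats the powers of `ρ`. -/
theorem exists_norm_coeff_mul_pow_le (a b u v : ℂ) {ρ : ℝ} (hρ : 0 < ρ) :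
    ∃ C, ∀ n, ‖coeff a b u v n‖ * ρ ^ n ≤ C := by
  set d : ℕ → ℝ := fun n => ‖coeff a b u v n‖ * ρ ^ n with hd
  set A : ℝ := 4 * ρ ^ 5 + ‖a‖ * ρ ^ 3 + ‖b‖ * ρ ^ 2 with hA
  obtain ⟨N, hN⟩ := exists_nat_ge A
  have hd0 : ∀ n, 0 ≤ d n := fun n => by positivity
  set C : ℝ := ∑ i ∈ Finset.range (N + 5), d i with hC
  have hC0 : 0 ≤ C := Finset.sum_nonneg fun i _ => hd0 i
  refine ⟨C, fun n => ?_⟩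
  induction n using Nat.strong_induction_on with
  | _ n ih =>
    by_cases hn : n < N + 5
    · exact Finset.single_le_sum (f := d) (fun i _ => hd0 i) (Finset.mem_range.2 hn)
    · obtain ⟨m, rfl⟩ : ∃ m, n = m + 5 := ⟨n - 5, by omega⟩
      have h0 := ih m (by omega)
      have h2 := ih (m + 2) (by omega)
      have h3 := ih (m + 3) (by omega)
      have hm : (N : ℝ) ≤ m := by exact_mod_cast (by omega : N ≤ m)
      have hpos : (0 : ℝ) < (m + 4) * (m + 5) := by positivity
      have hnorm : ‖((m : ℂ) + 4) * (m + 5)‖ = (m + 4) * (m + 5) := by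
        have : ((m : ℂ) + 4) * (m + 5) = (((m : ℝ) + 4) * (m + 5) : ℝ) := by push_cast; ring
        rw [this, Complex.norm_real, Real.norm_of_nonneg hpos.le]
      rw [coeff, norm_div, hnorm, div_mul_eq_mul_div, div_le_iff₀ hpos]
      calc ‖4 * coeff a b u v m - a * coeff a b u v (m + 2) - b * coeff a b u v (m + 3)‖
            * ρ ^ (m + 5)
          ≤ (4 * ‖coeff a b u v m‖ + ‖a‖ * ‖coeff a b u v (m + 2)‖
            + ‖b‖ * ‖coeff a b u v (m + 3)‖) * ρ ^ (m + 5) := by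
            gcongr
            refine (norm_sub_le _ _).trans (add_le_add ((norm_sub_le _ _).trans
              (add_le_add ?_ ?_)) ?_) <;> simp
        _ = 4 * ρ ^ 5 * (‖coeff a b u v m‖ * ρ ^ m)
            + ‖a‖ * ρ ^ 3 * (‖coeff a b u v (m + 2)‖ * ρ ^ (m + 2))
            + ‖b‖ * ρ ^ 2 * (‖coeff a b u v (m + 3)‖ * ρ ^ (m + 3)) := by ring
        _ ≤ 4 * ρ ^ 5 * C + ‖a‖ * ρ ^ 3 * C + ‖b‖ * ρ ^ 2 * C := by gcongr
        _ = C * A := by rw [hA]; ring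
        _ ≤ C * ((m + 4) * (m + 5)) := by
            gcongr
            nlinarith [(Nat.cast_nonneg m : (0 : ℝ) ≤ m)]

/-- A power series whose coefficients decay faster than every geometric sequence is entire and may
be differentiated term by term. -/
theorem hasDerivAt_tsum_of_coeff_bound {c : ℕ → ℂ}
    (hc : ∀ ρ : ℝ, 0 < ρ → ∃ C, ∀ n, ‖c n‖ * ρ ^ n ≤ C) (x : ℂ) :
    (Summable fun n => c n * x ^ n) ∧
      HasDerivAt (fun x => ∑' n, c n * x ^ n) (∑' n, (n + 1) * c (n + 1) * x ^ n) x := by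
  set r : ℝ := ‖x‖ + 1 with hr
  have hr0 : 0 < r := by positivity
  obtain ⟨C, hC⟩ := hc (2 * r) (by positivity)
  have hu : Summable fun n : ℕ => C * (1 / 2 : ℝ) ^ n :=
    (summable_geometric_of_lt_one (by norm_num) (by norm_num)).mul_left C
  have hb : ∀ (n : ℕ), ∀ w ∈ Metric.ball (0 : ℂ) r, ‖c n * w ^ n‖ ≤ C * (1 / 2) ^ n := by
    intro n w hw
    rw [mem_ball_zero_iff] at hw
    rw [norm_mul, norm_pow]
    calc ‖c n‖ * ‖w‖ ^ n ≤ ‖c n‖ * r ^ n := by gcongr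
      _ = (‖c n‖ * (2 * r) ^ n) * (1 / 2) ^ n := by
          rw [mul_assoc, ← mul_pow]; congr 2; ring
      _ ≤ C * (1 / 2) ^ n := by gcongr; exact hC n
  have hx : x ∈ Metric.ball (0 : ℂ) r := by rw [mem_ball_zero_iff, hr]; linarith
  have hF : ∀ n : ℕ, DifferentiableOn ℂ (fun w : ℂ => c n * w ^ n) (Metric.ball 0 r) :=
    fun n => by fun_prop
  refine ⟨hu.of_norm_bounded fun n => hb n x hx, ?_⟩
  have hd := (Complex.differentiableOn_tsum_of_summable_norm hu hF Metric.isOpen_ball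
    hb).differentiableAt (Metric.isOpen_ball.mem_nhds hx)
  have hs := Complex.hasSum_deriv_of_summable_norm hu hF Metric.isOpen_ball hb hx
  have h0 := hs.summable.tsum_eq_zero_add
  rw [hs.tsum_eq] at h0
  refine hd.hasDerivAt.congr_deriv ?_
  rw [h0]
  simp [mul_comm, mul_left_comm, mul_assoc]

/-- The bound passes to the coefficients of the derivative, since `n + 1 ≤ 2 ^ (n + 1)`. -/
theorem deriv_coeff_bound {c : ℕ → ℂ} (hc : ∀ ρ : ℝ, 0 < ρ → ∃ C, ∀ n, ‖c n‖ * ρ ^ n ≤ C) :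
    ∀ ρ : ℝ, 0 < ρ → ∃ C, ∀ n : ℕ, ‖(n + 1) * c (n + 1)‖ * ρ ^ n ≤ C := by
  intro ρ hρ
  obtain ⟨C, hC⟩ := hc (2 * ρ) (by positivity)
  refine ⟨C / ρ, fun n => ?_⟩
  rw [le_div_iff₀ hρ]
  refine le_trans ?_ (hC (n + 1))
  have h2 : ((n : ℝ) + 1) ≤ 2 ^ (n + 1) := by exact_mod_cast (Nat.lt_two_pow_self (n := n + 1)).le
  have hn : ‖((n : ℂ) + 1)‖ = n + 1 := by exact_mod_cast Complex.norm_natCast (n + 1)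
  rw [norm_mul, hn, mul_pow]
  calc (n + 1) * ‖c (n + 1)‖ * ρ ^ n * ρ = (n + 1) * (‖c (n + 1)‖ * ρ ^ (n + 1)) := by ring
    _ ≤ 2 ^ (n + 1) * (‖c (n + 1)‖ * ρ ^ (n + 1)) := by gcongr
    _ = _ := by ring

/-- The initial value problem at the origin has an entire solution. -/
theorem exists_isSolution (a b u v : ℂ) : ∃ ψ, IsSolution a b ψ ∧ ψ 0 = u ∧ deriv ψ 0 = v := by
  have h0 := fun ρ (hρ : 0 < ρ) => exists_norm_coeff_mul_pow_le a b u v hρ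
  have h1 := deriv_coeff_bound h0
  have hψ := hasDerivAt_tsum_of_coeff_bound h0
  have hψ' := hasDerivAt_tsum_of_coeff_bound h1
  have hψ'' := hasDerivAt_tsum_of_coeff_bound (deriv_coeff_bound h1)
  refine ⟨fun x => ∑' n, coeff a b u v n * x ^ n,
    isSolution_of_hasDerivAt (fun x => (hψ x).2) fun x => ?_, ?_, ?_⟩
  · refine (hψ' x).2.congr_deriv ?_
    -- compare coefficients, the terms of low degree separately
    have s := (hψ x).1
    have e1 := s.sum_add_tsum_nat_add 2
    have e2 := s.sum_add_tsum_nat_add 3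
    have e3 := (hψ'' x).1.sum_add_tsum_nat_add 3
    simp only [Finset.sum_range_succ, Finset.sum_range_zero] at e1 e2 e3
    push_cast at e3 ⊢
    rw [← e3]
    have s2 := (summable_nat_add_iff 2).2 s
    have s3 := (summable_nat_add_iff 3).2 s
    have key : ∑' n : ℕ, ((n : ℂ) + 3 + 1) * ((n + 3 + 1 + 1) * coeff a b u v (n + 3 + 1 + 1)) *
        x ^ (n + 3) = 4 * x ^ 3 * (∑' n, coeff a b u v n * x ^ n)
          - a * x * (∑' n, coeff a b u v (n + 2) * x ^ (n + 2))
          - b * (∑' n, coeff a b u v (n + 3) * x ^ (n + 3)) := by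
      rw [← tsum_mul_left, ← tsum_mul_left, ← tsum_mul_left,
        ← (s.mul_left _).tsum_sub (s2.mul_left _),
        ← ((s.mul_left _).sub (s2.mul_left _)).tsum_sub (s3.mul_left _)]
      refine tsum_congr fun n => ?_
      have h4 : (n : ℂ) + 4 ≠ 0 := by exact_mod_cast (by omega : n + 4 ≠ 0)
      have h5 : (n : ℂ) + 5 ≠ 0 := by exact_mod_cast (by omega : n + 5 ≠ 0)
      rw [coeff]
      have h31 : (n : ℂ) + 3 + 1 = n + 4 := by ring
      rw [h31]
      have h41 : (n : ℂ) + 4 + 1 = n + 5 := by ring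
      rw [h41]
      field_simp
      ring
    rw [key, eq_sub_of_add_eq' e1, eq_sub_of_add_eq' e2]
    simp only [potential, coeff]
    ring
  · refine (tsum_eq_single 0 fun n hn => by simp [hn]).trans ?_
    simp [coeff]
  · rw [(hψ 0).2.deriv, tsum_eq_single 0 fun n hn => by simp [hn]]
    simp [coeff]

/-- The initial value problem at `x` is solved by a combination of two solutions with Wronskian `1`,
so no expansion at `x` is needed. -/
theorem exists_isSolution_at (a b x u v : ℂ) :
    ∃ ψ, IsSolution a b ψ ∧ ψ x = u ∧ deriv ψ x = v := by
  obtain ⟨φ, hφ, hφ0, hφ1⟩ := exists_isSolution a b 1 0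
  obtain ⟨χ, hχ, hχ0, hχ1⟩ := exists_isSolution a b 0 1
  have hw : φ x * deriv χ x - deriv φ x * χ x = 1 := by
    rw [wr_eq hφ hχ, wr, hφ0, hφ1, hχ0, hχ1]; ring
  refine ⟨_, hφ.lincomb hχ (u * deriv χ x - v * χ x) (v * φ x - u * deriv φ x), ?_, ?_⟩
  · linear_combination u * hw
  · rw [deriv_lincomb hφ hχ]
    linear_combination v * hw

theorem exists_wr_eq_one (a b : ℂ) :
    ∃ φ χ, IsSolution a b φ ∧ IsSolution a b χ ∧ wr φ χ = 1 := by
  obtain ⟨φ, hφ, hφ0, hφ1⟩ := exists_isSolution a b 1 0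
  obtain ⟨χ, hχ, hχ0, hχ1⟩ := exists_isSolution a b 0 1
  exact ⟨φ, χ, hφ, hχ, by simp [wr, *]⟩

/-- Linear independence amounts to a nonzero Wronskian. -/
theorem isSolutionBasis_iff {a b : ℂ} {φ χ : ℂ → ℂ} :
    IsSolutionBasis a b φ χ ↔ IsSolution a b φ ∧ IsSolution a b χ ∧ wr φ χ ≠ 0 := by
  refine and_congr_right fun hφ => and_congr_right fun hχ => ?_
  rw [LinearIndependent.pair_iff]
  constructor
  · intro h hw
    obtain ⟨e, f, he, hf, hef⟩ := exists_wr_eq_one a b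
    -- the coordinates of `φ` and `χ` in a basis are proportional
    have hcomb : ∀ α β : ℂ, α * wr φ f + β * wr χ f = 0 → α * wr e φ + β * wr e χ = 0 →
        α = 0 ∧ β = 0 := fun α β h₁ h₂ => h α β <| funext fun x => by
      have hφx := wr_mul_apply hφ hf he x
      have hχx := wr_mul_apply hχ hf he x
      rw [hef, one_mul] at hφx hχx
      simp only [Pi.add_apply, Pi.smul_apply, smul_eq_mul, Pi.zero_apply, hφx, hχx]
      linear_combination e x * h₁ + f x * h₂
    have hdet : wr φ f * wr e χ - wr χ f * wr e φ = 0 := by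
      have : wr φ f * wr e χ - wr χ f * wr e φ = wr φ χ * wr e f := by unfold wr; ring
      rw [this, hw, zero_mul]
    have h1 := hcomb (wr χ f) (-wr φ f) (by ring) (by linear_combination -hdet)
    have h2 := hcomb (wr e χ) (-wr e φ) (by linear_combination hdet) (by ring)
    have h3 := hcomb 1 1 (by linear_combination h1.1 - h1.2) (by linear_combination h2.1 - h2.2)
    exact one_ne_zero h3.1
  · intro hw α β h
    have h0 := congrFun h
    simp only [Pi.add_apply, Pi.smul_apply, smul_eq_mul, Pi.zero_apply] at h0
    have hd : α * deriv φ 0 + β * deriv χ 0 = 0 := by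
      rw [← deriv_lincomb hφ hχ, funext h0, deriv_const]
    have e0 := h0 0
    constructor
    · refine (mul_eq_zero.1 (?_ : α * wr φ χ = 0)).resolve_right hw
      unfold wr; linear_combination deriv χ 0 * e0 - χ 0 * hd
    · refine (mul_eq_zero.1 (?_ : β * wr φ χ = 0)).resolve_right hw
      unfold wr; linear_combination φ 0 * hd - deriv φ 0 * e0

theorem exists_isSolutionBasis (a b : ℂ) : ∃ φ χ : ℂ → ℂ, IsSolutionBasis a b φ χ := by
  obtain ⟨φ, χ, hφ, hχ, h⟩ := exists_wr_eq_one a b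
  exact ⟨φ, χ, isSolutionBasis_iff.2 ⟨hφ, hχ, by simp [h]⟩⟩

/-! ### Growth and decay along lines -/

/-- Gronwall's inequality: if `k J ≤ J'`, then `J` grows at least like `exp (∫ k)`. -/
theorem mul_exp_le_of_mul_le_deriv {J J' K k : ℝ → ℝ} {s₀ : ℝ}
    (hJ : ∀ s, s₀ ≤ s → HasDerivAt J (J' s) s) (hK : ∀ s, s₀ ≤ s → HasDerivAt K (k s) s)
    (h : ∀ s, s₀ ≤ s → k s * J s ≤ J' s) {s : ℝ} (hs : s₀ ≤ s) :
    J s₀ * Real.exp (K s - K s₀) ≤ J s := by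
  have hG : ∀ s, s₀ ≤ s → HasDerivAt (fun s => J s * Real.exp (-K s))
      ((J' s - k s * J s) * Real.exp (-K s)) s := fun s hs =>
    ((hJ s hs).mul (hK s hs).fun_neg.exp).congr_deriv (by ring)
  have hmono : MonotoneOn (fun s => J s * Real.exp (-K s)) (Set.Ici s₀) := by
    refine monotoneOn_of_deriv_nonneg (convex_Ici s₀)
      (fun s hs => (hG s hs).continuousAt.continuousWithinAt)
      (fun s hs => (hG s (interior_subset hs)).differentiableAt.differentiableWithinAt)
      fun s hs => ?_
    rw [(hG s (interior_subset hs)).deriv]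
    exact mul_nonneg (sub_nonneg.2 (h s (interior_subset hs))) (Real.exp_pos _).le
  have := hmono Set.self_mem_Ici hs hs
  calc J s₀ * Real.exp (K s - K s₀) = J s₀ * Real.exp (-K s₀) * Real.exp (K s) := by
        rw [mul_assoc, ← Real.exp_add]; ring_nf
    _ ≤ J s * Real.exp (-K s) * Real.exp (K s) := by gcongr
    _ = J s := by rw [mul_assoc, ← Real.exp_add]; simp

/-- The combinations `ψ' (t ^ 2) ± 2 t ^ 3 ψ (t ^ 2)`, for `s = ± 1`. In the variable `t`, with
`x = t ^ 2`, the two exponential behaviours `exp (± 4 t ^ 5 / 5)` of the solutions are decoupled up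
to bounded terms by these combinations, and no fractional powers occur. -/
noncomputable def amp (s : ℂ) (ψ : ℂ → ℂ) (t : ℂ) : ℂ := deriv ψ (t ^ 2) + 2 * s * t ^ 3 * ψ (t ^ 2)

/-- The coupling term in the equation for `amp s ψ`. -/
noncomputable def ampErr (a b s : ℂ) (ψ : ℂ → ℂ) (t : ℂ) : ℂ :=
  (-2 * a * t ^ 3 - 2 * b * t + 6 * s * t ^ 2) * ψ (t ^ 2)

/-- A bound for the coupling of `amp 1 ψ` and `amp (-1) ψ`. -/
noncomputable def couplingBound (a b : ℂ) : ℝ := (‖a‖ + ‖b‖ + 3) / 2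

theorem couplingBound_pos (a b : ℂ) : 0 < couplingBound a b := by
  unfold couplingBound; positivity

theorem IsSolution.hasDerivAt_amp {a b s : ℂ} {ψ : ℂ → ℂ} (h : IsSolution a b ψ) (hs : s ^ 2 = 1)
    (t : ℂ) : HasDerivAt (amp s ψ) (4 * s * t ^ 4 * amp s ψ t + ampErr a b s ψ t) t := by
  have h2 : HasDerivAt (fun t : ℂ => t ^ 2) (2 * t) t := by simpa using hasDerivAt_pow 2 t
  have h3 : HasDerivAt (fun t : ℂ => 2 * s * t ^ 3) (2 * s * (3 * t ^ 2)) t := by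
    simpa using (hasDerivAt_pow 3 t).const_mul (2 * s)
  refine (((h.hasDerivAt_deriv (t ^ 2)).comp t h2).add
    (h3.mul ((h.hasDerivAt (t ^ 2)).comp t h2))).congr_deriv ?_
  simp only [amp, ampErr, potential, Function.comp]
  linear_combination (-8 * t ^ 7 * ψ (t ^ 2)) * hs

theorem amp_one_sub (ψ : ℂ → ℂ) (t : ℂ) : amp 1 ψ t - amp (-1) ψ t = 4 * t ^ 3 * ψ (t ^ 2) := by
  unfold amp; ring

theorem norm_amp_sub (ψ : ℂ → ℂ) (t : ℂ) :
    ‖amp 1 ψ t - amp (-1) ψ t‖ = 4 * ‖t‖ ^ 3 * ‖ψ (t ^ 2)‖ := by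
  rw [amp_one_sub]; simp

theorem norm_ampErr_le (a b : ℂ) {s : ℂ} (hs : ‖s‖ = 1) (ψ : ℂ → ℂ) {t : ℂ} (ht : 1 ≤ ‖t‖) :
    ‖ampErr a b s ψ t‖ ≤ couplingBound a b * (‖amp 1 ψ t‖ + ‖amp (-1) ψ t‖) := by
  have h1 : ‖t‖ ≤ ‖t‖ ^ 3 := le_self_pow₀ ht (by norm_num)
  have h2 : ‖t‖ ^ 2 ≤ ‖t‖ ^ 3 := pow_le_pow_right₀ ht (by norm_num)
  calc ‖ampErr a b s ψ t‖
      ≤ (2 * ‖a‖ * ‖t‖ ^ 3 + 2 * ‖b‖ * ‖t‖ + 6 * ‖t‖ ^ 2) * ‖ψ (t ^ 2)‖ := by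
        rw [ampErr, norm_mul]
        gcongr
        refine (norm_add_le _ _).trans (add_le_add ((norm_sub_le _ _).trans
          (add_le_add ?_ ?_)) ?_) <;> simp [hs]
    _ ≤ (2 * ‖a‖ * ‖t‖ ^ 3 + 2 * ‖b‖ * ‖t‖ ^ 3 + 6 * ‖t‖ ^ 3) * ‖ψ (t ^ 2)‖ := by gcongr
    _ = couplingBound a b * ‖amp 1 ψ t - amp (-1) ψ t‖ := by
        rw [norm_amp_sub, couplingBound]; ring
    _ ≤ _ := by
        gcongr
        · exact (couplingBound_pos a b).le
        · exact norm_sub_le _ _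

theorem inner_mul_add_bounds {L p E : ℂ} {k : ℝ} (hL : k ≤ L.re) :
    k * ‖p‖ ^ 2 - ‖p‖ * ‖E‖ ≤ inner ℝ p (L * p + E) ∧
      inner ℝ p (-L * p + E) ≤ -k * ‖p‖ ^ 2 + ‖p‖ * ‖E‖ := by
  have h1 : ∀ L : ℂ, inner ℝ p (L * p) = L.re * ‖p‖ ^ 2 := fun L => by
    rw [Complex.inner, ← Complex.normSq_eq_norm_sq, Complex.normSq_apply]
    simp; ring
  have h2 := abs_le.1 (abs_real_inner_le_norm p E)
  have h3 : k * ‖p‖ ^ 2 ≤ L.re * ‖p‖ ^ 2 := by gcongr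
  rw [inner_add_right, inner_add_right, h1, h1, Complex.neg_re]
  constructor <;> nlinarith [h2.1, h2.2]

/-- The line through `t₀` in the direction `m`, with the parameter shifted so that it is `t₀` at the
point `t₀`; for `t₀ ≥ 0` and a growth direction `m` the parameter `σ` is comparable to the
modulus. -/
noncomputable def line (t₀ : ℝ) (m : ℂ) (σ : ℝ) : ℂ := t₀ + (σ - t₀ : ℝ) * m

theorem norm_line_le {t₀ σ : ℝ} {m : ℂ} (hm : ‖m‖ = 1) (h₀ : 0 ≤ t₀) (h : t₀ ≤ σ) :
    ‖line t₀ m σ‖ ≤ σ := by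
  refine (norm_add_le _ _).trans ?_
  rw [norm_mul, hm, Complex.norm_real, Complex.norm_real, Real.norm_of_nonneg h₀,
    Real.norm_of_nonneg (sub_nonneg.2 h)]
  linarith

/-- Directions `m` for which `exp (4 t ^ 5 / 5)` grows along all lines that start on the positive
axis, with the rate controlled by `κ`. -/
structure GrowthDirection (κ : ℝ) (m : ℂ) : Prop where
  norm_eq : ‖m‖ = 1
  le_re : ∀ j : ℕ, 1 ≤ j → j ≤ 5 → κ ≤ (m ^ j).re

theorem growthDirection_exp {η₀ η : ℝ} (h₀ : 5 * η₀ ≤ Real.pi / 2) (h : |η| ≤ η₀) :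
    GrowthDirection (Real.cos (5 * η₀)) (Complex.exp (η * Complex.I)) where
  norm_eq := Complex.norm_exp_ofReal_mul_I η
  le_re := fun j _ hj => by
    have hj' : (j : ℝ) ≤ 5 := by exact_mod_cast hj
    have hre : (Complex.exp (η * Complex.I) ^ j).re = Real.cos (j * η) := by
      rw [← Complex.exp_nat_mul, ← Complex.exp_ofReal_mul_I_re]
      push_cast; ring_nf
    rw [hre, ← Real.cos_abs (j * η), abs_mul, Nat.abs_cast]
    have hη := (abs_nonneg η).trans h
    refine Real.cos_le_cos_of_nonneg_of_le_pi (by positivity) (by linarith [Real.pi_pos]) ?_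
    gcongr

theorem GrowthDirection.mul_le_re_line {κ : ℝ} {m : ℂ} (h : GrowthDirection κ m) {t₀ σ : ℝ}
    (h₀ : 0 ≤ t₀) (hσ : t₀ ≤ σ) (hκ : κ ≤ 1) : κ * σ ≤ (line t₀ m σ).re := by
  have h1 : κ ≤ m.re := by simpa using h.le_re 1 le_rfl (by norm_num)
  have : (line t₀ m σ).re = t₀ + (σ - t₀) * m.re := by simp [line]
  rw [this]
  nlinarith [mul_le_mul_of_nonneg_left h1 (sub_nonneg.2 hσ), mul_le_mul_of_nonneg_right hκ h₀]

/-- The binomial expansion of `m (t₀ + v m) ^ 4` has nonnegative coefficients, and all the powers of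
`m` that occur have real part at least `κ`. -/
theorem GrowthDirection.mul_le_re_mul_line_pow {κ : ℝ} {m : ℂ} (h : GrowthDirection κ m)
    {t₀ σ : ℝ} (h₀ : 0 ≤ t₀) (hσ : t₀ ≤ σ) : κ * σ ^ 4 ≤ (m * line t₀ m σ ^ 4).re := by
  obtain ⟨v, rfl⟩ : ∃ v, σ = t₀ + v := ⟨σ - t₀, by ring⟩
  have hv : 0 ≤ v := by linarith
  have he : m * line t₀ m (t₀ + v) ^ 4 = (t₀ ^ 4 : ℝ) * m ^ 1 + (4 * t₀ ^ 3 * v : ℝ) * m ^ 2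
      + (6 * t₀ ^ 2 * v ^ 2 : ℝ) * m ^ 3 + (4 * t₀ * v ^ 3 : ℝ) * m ^ 4 + (v ^ 4 : ℝ) * m ^ 5 := by
    simp only [line]; push_cast; ring
  rw [he]
  simp only [Complex.add_re, Complex.re_ofReal_mul]
  calc κ * (t₀ + v) ^ 4 = t₀ ^ 4 * κ + 4 * t₀ ^ 3 * v * κ + 6 * t₀ ^ 2 * v ^ 2 * κ
        + 4 * t₀ * v ^ 3 * κ + v ^ 4 * κ := by ring
    _ ≤ _ := by gcongr <;> exact h.le_re _ (by norm_num) (by norm_num)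

theorem IsSolution.hasDerivAt_norm_sq_amp {a b s : ℂ} {ψ : ℂ → ℂ} (h : IsSolution a b ψ)
    (hs : s ^ 2 = 1) (t₀ : ℝ) (m : ℂ) (σ : ℝ) :
    HasDerivAt (fun σ => ‖amp s ψ (line t₀ m σ)‖ ^ 2)
      (2 * inner ℝ (amp s ψ (line t₀ m σ)) (s * (4 * (m * line t₀ m σ ^ 4)) * amp s ψ (line t₀ m σ)
        + m * ampErr a b s ψ (line t₀ m σ))) σ := by
  have hl : HasDerivAt (line t₀ m) m σ := by
    have : HasDerivAt (fun σ : ℝ => ((σ - t₀ : ℝ) : ℂ)) 1 σ := by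
      simpa using ((hasDerivAt_id σ).sub_const t₀).ofReal_comp
    exact ((this.mul_const m).const_add (t₀ : ℂ)).congr_deriv (one_mul m)
  have := (h.hasDerivAt_amp hs (line t₀ m σ)).comp_of_eq σ hl rfl
  refine (this.congr_deriv ?_).norm_sq
  ring

section line

variable {a b m : ℂ} {ψ : ℂ → ℂ} {κ t₀ σ₀ σ : ℝ}

/-- The derivatives of `‖amp 1 ψ‖ ^ 2` and `‖amp (-1) ψ‖ ^ 2` along a line in a growth direction,
halved and estimated by the diagonal rate `4 κ σ ^ 4`, which dominates the coupling for large `σ`. -/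
theorem inner_amp_bounds (hm : GrowthDirection κ m) (hκ₁ : κ ≤ 1)
    (h₀ : 0 ≤ t₀) (hσ : t₀ ≤ σ) (h₁ : 1 ≤ κ * σ) (h₂ : 2 * couplingBound a b ≤ κ * σ)
    {p q P Q : ℂ} (hp : p = amp 1 ψ (line t₀ m σ)) (hq : q = amp (-1) ψ (line t₀ m σ))
    (hP : P = 1 * (4 * (m * line t₀ m σ ^ 4)) * p + m * ampErr a b 1 ψ (line t₀ m σ))
    (hQ : Q = -1 * (4 * (m * line t₀ m σ ^ 4)) * q + m * ampErr a b (-1) ψ (line t₀ m σ)) :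
    8 * couplingBound a b ≤ 4 * κ * σ ^ 4 ∧
    4 * κ * σ ^ 4 * ‖p‖ ^ 2 - ‖p‖ * (couplingBound a b * (‖p‖ + ‖q‖)) ≤ inner ℝ p P ∧
      inner ℝ q Q ≤ -(4 * κ * σ ^ 4) * ‖q‖ ^ 2 + ‖q‖ * (couplingBound a b * (‖p‖ + ‖q‖)) := by
  have hσ0 : 0 ≤ σ := h₀.trans hσ
  have hσ1 : 1 ≤ σ := h₁.trans (mul_le_of_le_one_left hσ0 hκ₁)
  have hκ : 0 ≤ κ := by
    by_contra! hneg
    nlinarith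
  have ht : 1 ≤ ‖line t₀ m σ‖ :=
    (h₁.trans (hm.mul_le_re_line h₀ hσ hκ₁)).trans (Complex.re_le_norm _)
  have hL : 4 * κ * σ ^ 4 ≤ (4 * (m * line t₀ m σ ^ 4)).re := by
    have := hm.mul_le_re_mul_line_pow h₀ hσ
    have h4 : (4 * (m * line t₀ m σ ^ 4)).re = 4 * (m * line t₀ m σ ^ 4).re := by
      simp
    rw [h4]; linarith
  have hE : ∀ s : ℂ, ‖s‖ = 1 → ‖m * ampErr a b s ψ (line t₀ m σ)‖
      ≤ couplingBound a b * (‖p‖ + ‖q‖) := fun s hs => by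
    rw [norm_mul, hm.norm_eq, one_mul, hp, hq]
    exact norm_ampErr_le a b hs ψ ht
  refine ⟨?_, ?_, ?_⟩
  · have : σ ≤ σ ^ 4 := le_self_pow₀ hσ1 (by norm_num)
    nlinarith [mul_le_mul_of_nonneg_left this hκ]
  · rw [hP, one_mul]
    refine le_trans ?_ (inner_mul_add_bounds hL).1
    gcongr
    exact hE 1 (by simp)
  · rw [hQ, neg_one_mul]
    refine (inner_mul_add_bounds hL).2.trans ?_
    gcongr
    exact hE (-1) (by simp)

theorem hasDerivAt_rate (κ σ : ℝ) :
    HasDerivAt (fun σ : ℝ => 4 * κ / 5 * σ ^ 5) (4 * κ * σ ^ 4) σ :=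
  ((hasDerivAt_pow 5 σ).const_mul _).congr_deriv (by norm_num; ring)

/-- The cone `2 |q| < |p|`, for `p = amp 1 ψ` and `q = amp (-1) ψ`, is invariant in growth
directions, and solutions grow exponentially in it. -/
theorem IsSolution.amp_growth (h : IsSolution a b ψ) (hm : GrowthDirection κ m) (hκ : 0 < κ)
    (hκ₁ : κ ≤ 1) (h₀ : 0 ≤ t₀) (hσ₀ : t₀ ≤ σ₀) (h₁ : 1 ≤ κ * σ₀)
    (h₂ : 2 * couplingBound a b ≤ κ * σ₀) (hσ : σ₀ ≤ σ) :
    (‖amp 1 ψ (line t₀ m σ₀)‖ ^ 2 - 4 * ‖amp (-1) ψ (line t₀ m σ₀)‖ ^ 2)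
        * Real.exp (4 * κ / 5 * σ ^ 5 - 4 * κ / 5 * σ₀ ^ 5)
      ≤ ‖amp 1 ψ (line t₀ m σ)‖ ^ 2 - 4 * ‖amp (-1) ψ (line t₀ m σ)‖ ^ 2 := by
  refine mul_exp_le_of_mul_le_deriv
    (J := fun σ => ‖amp 1 ψ (line t₀ m σ)‖ ^ 2 - 4 * ‖amp (-1) ψ (line t₀ m σ)‖ ^ 2)
    (K := fun σ => 4 * κ / 5 * σ ^ 5)
    (fun σ _ => (h.hasDerivAt_norm_sq_amp (by norm_num) t₀ m σ).sub
      ((h.hasDerivAt_norm_sq_amp (by norm_num) t₀ m σ).const_mul 4))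
    (fun σ _ => hasDerivAt_rate κ σ) (fun σ hσ => ?_) hσ
  have hκσ : κ * σ₀ ≤ κ * σ := by gcongr
  obtain ⟨hk, hp, hq⟩ := inner_amp_bounds (ψ := ψ) hm hκ₁ h₀ (hσ₀.trans hσ)
    (h₁.trans hκσ) (h₂.trans hκσ) rfl rfl rfl rfl
  have hM := couplingBound_pos a b
  generalize couplingBound a b = M at *
  set k := 4 * κ * σ ^ 4
  set x := ‖amp 1 ψ (line t₀ m σ)‖
  set y := ‖amp (-1) ψ (line t₀ m σ)‖
  have h1 : 8 * M * x ^ 2 ≤ k * x ^ 2 := by gcongr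
  have h2 : 8 * M * y ^ 2 ≤ k * y ^ 2 := by gcongr
  nlinarith [mul_nonneg hM.le (sq_nonneg (x - y))]

/-- A solution that never enters the cone of `IsSolution.amp_growth` decays exponentially. -/
theorem IsSolution.amp_decay (h : IsSolution a b ψ) (hm : GrowthDirection κ m) (hκ : 0 < κ)
    (hκ₁ : κ ≤ 1) (h₀ : 0 ≤ t₀) (hσ₀ : t₀ ≤ σ₀) (h₁ : 1 ≤ κ * σ₀)
    (h₂ : 2 * couplingBound a b ≤ κ * σ₀)
    (hcone : ∀ σ, σ₀ ≤ σ → ‖amp 1 ψ (line t₀ m σ)‖ ^ 2 ≤ 4 * ‖amp (-1) ψ (line t₀ m σ)‖ ^ 2)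
    (hσ : σ₀ ≤ σ) :
    ‖amp (-1) ψ (line t₀ m σ)‖ ^ 2 ≤ ‖amp (-1) ψ (line t₀ m σ₀)‖ ^ 2
        * Real.exp (-(4 * κ / 5 * σ ^ 5) + 4 * κ / 5 * σ₀ ^ 5) := by
  have := mul_exp_le_of_mul_le_deriv (K := fun σ => -(4 * κ / 5 * σ ^ 5)) (s₀ := σ₀)
    (fun σ _ => (h.hasDerivAt_norm_sq_amp (s := -1) (by norm_num) t₀ m σ).fun_neg)
    (fun σ _ => (hasDerivAt_rate κ σ).fun_neg) (fun σ hσ => ?_) hσ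
  · rw [sub_neg_eq_add] at this
    linarith
  have hκσ : κ * σ₀ ≤ κ * σ := by gcongr
  obtain ⟨hk, hp, hq⟩ := inner_amp_bounds (ψ := ψ) hm hκ₁ h₀ (hσ₀.trans hσ)
    (h₁.trans hκσ) (h₂.trans hκσ) rfl rfl rfl rfl
  have hM := couplingBound_pos a b
  have hxy : ‖amp 1 ψ (line t₀ m σ)‖ ≤ 2 * ‖amp (-1) ψ (line t₀ m σ)‖ :=
    le_of_sq_le_sq (by linarith [hcone σ hσ]) (by positivity)
  generalize couplingBound a b = M at *
  set k := 4 * κ * σ ^ 4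
  set x := ‖amp 1 ψ (line t₀ m σ)‖
  set y := ‖amp (-1) ψ (line t₀ m σ)‖
  have hy : 0 ≤ y := norm_nonneg _
  have h2 : 8 * M * y ^ 2 ≤ k * y ^ 2 := by gcongr
  have h3 : y * (M * (x + y)) ≤ y * (M * (2 * y + y)) := by gcongr
  nlinarith [mul_nonneg hM.le (sq_nonneg y)]

/-- The constant in the growth estimate for a solution that enters the cone of
`IsSolution.amp_growth` at the parameter `σ₀`. -/
noncomputable def growthConst (κ σ₀ j : ℝ) : ℝ :=
  j * Real.exp (-(4 * κ / 5 * σ₀ ^ 5)) * (4 * κ / 5) ^ 2 / 128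

theorem growthConst_pos {κ σ₀ j : ℝ} (hκ : 0 < κ) (hj : 0 < j) : 0 < growthConst κ σ₀ j := by
  unfold growthConst; positivity

theorem IsSolution.le_norm_sq_of_cone (h : IsSolution a b ψ) (hm : GrowthDirection κ m)
    (hκ : 0 < κ) (hκ₁ : κ ≤ 1) (h₀ : 0 ≤ t₀) (hσ₀ : t₀ ≤ σ₀) (h₁ : 1 ≤ κ * σ₀)
    (h₂ : 2 * couplingBound a b ≤ κ * σ₀) {j : ℝ} (hj : 0 < j)
    (hJ : j ≤ ‖amp 1 ψ (line t₀ m σ₀)‖ ^ 2 - 4 * ‖amp (-1) ψ (line t₀ m σ₀)‖ ^ 2)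
    (hσ : σ₀ ≤ σ) :
    growthConst κ σ₀ j * σ ^ 4 ≤ ‖ψ (line t₀ m σ ^ 2)‖ ^ 2 := by
  have hgr := h.amp_growth hm hκ hκ₁ h₀ hσ₀ h₁ h₂ hσ
  have hσ0 : 0 < σ₀ := pos_of_mul_pos_right (one_pos.trans_le h₁) hκ.le
  have hσp : 0 < σ := hσ0.trans_le hσ
  have ht : ‖line t₀ m σ‖ ≤ σ := norm_line_le hm.norm_eq h₀ (hσ₀.trans hσ)
  have hsub := norm_amp_sub ψ (line t₀ m σ)
  have htri := norm_sub_norm_le (amp 1 ψ (line t₀ m σ)) (amp (-1) ψ (line t₀ m σ))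
  rw [hsub] at htri
  have hexp := Real.pow_div_factorial_le_exp (4 * κ / 5 * σ ^ 5) (by positivity) 2
  rw [sub_eq_add_neg (4 * κ / 5 * σ ^ 5), Real.exp_add] at hgr
  rw [growthConst]
  set e := Real.exp (-(4 * κ / 5 * σ₀ ^ 5))
  have he : 0 < e := Real.exp_pos _
  set x := ‖amp 1 ψ (line t₀ m σ)‖
  set y := ‖amp (-1) ψ (line t₀ m σ)‖
  set z := ‖ψ (line t₀ m σ ^ 2)‖
  have hz : 0 ≤ z := norm_nonneg _
  have h5 : j * ((4 * κ / 5 * σ ^ 5) ^ 2 / 2 * e) ≤ x ^ 2 - 4 * y ^ 2 := by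
    refine (mul_le_mul hJ ?_ (by positivity) (hj.le.trans hJ)).trans hgr
    gcongr
    simpa using hexp
  have h6 : 0 ≤ j * ((4 * κ / 5 * σ ^ 5) ^ 2 / 2 * e) := by positivity
  have hyx : 2 * y ≤ x := le_of_sq_le_sq (by linarith) (norm_nonneg _)
  have h7 : x ≤ 8 * σ ^ 3 * z := by
    have : 4 * ‖line t₀ m σ‖ ^ 3 * z ≤ 4 * σ ^ 3 * z := by gcongr
    linarith
  have h8 : x ^ 2 ≤ (8 * σ ^ 3 * z) ^ 2 := pow_le_pow_left₀ (norm_nonneg _) h7 2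
  have h9 : (j * e * (4 * κ / 5) ^ 2 / 128 * σ ^ 4) * (64 * σ ^ 6) ≤ z ^ 2 * (64 * σ ^ 6) := by
    nlinarith [sq_nonneg y]
  exact le_of_mul_le_mul_right h9 (by positivity)

end line

/-! ### Growing and decaying solutions on sectors -/

theorem cos_five_mul_bounds {η₀ : ℝ} (h₀ : 0 ≤ η₀) (h : η₀ < Real.pi / 10) :
    0 < Real.cos (5 * η₀) ∧ Real.cos (5 * η₀) ≤ 1 :=
  ⟨Real.cos_pos_of_mem_Ioo ⟨by linarith [Real.pi_pos], by linarith⟩, Real.cos_le_one _⟩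

theorem exists_forall_le_mul (a b : ℂ) {κ : ℝ} (hκ : 0 < κ) :
    ∃ T > 0, ∀ σ, T ≤ σ → 1 ≤ κ * σ ∧ 2 * couplingBound a b ≤ κ * σ := by
  refine ⟨max (1 / κ) (2 * couplingBound a b / κ), by positivity, fun σ hσ => ?_⟩
  rw [max_le_iff, div_le_iff₀' hκ, div_le_iff₀' hκ] at hσ
  exact hσ

theorem ofReal_sqrt_mul_exp_sq {r : ℝ} (hr : 0 ≤ r) (θ : ℝ) :
    ((Real.sqrt r : ℂ) * Complex.exp ((θ / 2 : ℝ) * Complex.I)) ^ 2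
      = r * Complex.exp (θ * Complex.I) := by
  rw [mul_pow, ← Complex.exp_nat_mul, ← Complex.ofReal_pow, Real.sq_sqrt hr]
  congr 2
  push_cast; ring

/-- A solution that grows in a whole proper subsector: it is started in the cone of
`IsSolution.amp_growth` at a point far out on the positive axis, from which all points far out in
the subsector are reached along lines in growth directions. -/
theorem exists_growing (a b : ℂ) {ε : ℝ} (hε : 0 < ε) (hε' : ε < Real.pi / 5) :
    ∃ D, IsSolution a b D ∧ ∃ c > 0, ∃ R > 0, ∀ r : ℝ, R ≤ r → ∀ θ : ℝ, |θ| ≤ Real.pi / 5 - ε →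
      c * r ^ 2 ≤ ‖D (r * Complex.exp (θ * Complex.I))‖ ^ 2 := by
  set η₀ : ℝ := Real.pi / 10 - ε / 4 with hη₀
  obtain ⟨hκ, hκ₁⟩ := cos_five_mul_bounds (η₀ := η₀) (by linarith) (by linarith)
  set κ := Real.cos (5 * η₀)
  obtain ⟨T, hT, hTσ⟩ := exists_forall_le_mul a b hκ
  obtain ⟨D, hD, hD0, hD1⟩ := exists_isSolution_at a b (T ^ 2) 1 (2 * T ^ 3)
  have hq : amp (-1) D T = 0 := by simp only [amp, hD0, hD1]; ring
  have hp : amp 1 D T ≠ 0 := by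
    have : amp 1 D T = (4 * T ^ 3 : ℝ) := by simp only [amp, hD0, hD1]; push_cast; ring
    rw [this]
    exact_mod_cast (by positivity : (4 * T ^ 3 : ℝ) ≠ 0)
  -- the argument of `1 - T / t` is small for large `t`
  have harg : ∀ᶠ z : ℂ in 𝓝 0, |Complex.arg (1 - z)| < ε / 4 := by
    have : Tendsto (fun z : ℂ => |Complex.arg (1 - z)|) (𝓝 0) (𝓝 0) := by
      have hc : ContinuousAt (fun z : ℂ => |Complex.arg (1 - z)|) 0 :=
        (ContinuousAt.comp (f := fun z : ℂ => 1 - z) (g := Complex.arg)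
          (Complex.continuousAt_arg (by simp)) (by fun_prop)).abs
      simpa [ContinuousAt] using hc
    exact this.eventually_lt_const (by linarith)
  obtain ⟨δ, hδ, hδz⟩ := Metric.eventually_nhds_iff.1 harg
  refine ⟨D, hD, growthConst κ T (‖amp 1 D T‖ ^ 2), growthConst_pos hκ (by positivity),
    (T / δ + 1) ^ 2, by positivity, fun r hr θ hθ => ?_⟩
  have hr0 : 0 < r := lt_of_lt_of_le (by positivity) hr
  set ρ := Real.sqrt r with hρ
  have hρr : T / δ + 1 ≤ ρ := Real.le_sqrt_of_sq_le hr
  have hρ0 : 0 < ρ := Real.sqrt_pos.2 hr0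
  set t : ℂ := ρ * Complex.exp ((θ / 2 : ℝ) * Complex.I) with ht
  have htn : ‖t‖ = ρ := by
    rw [ht, norm_mul, Complex.norm_exp_ofReal_mul_I, Complex.norm_real,
      Real.norm_of_nonneg hρ0.le, mul_one]
  have ht0 : t ≠ 0 := norm_ne_zero_iff.1 (by rw [htn]; exact hρ0.ne')
  set w : ℂ := 1 - T / t with hw
  have hα : |Complex.arg w| < ε / 4 := by
    refine hδz ?_
    rw [dist_zero_right, norm_div, htn, Complex.norm_real, Real.norm_of_nonneg hT.le,
      div_lt_iff₀ hρ0]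
    have := (div_lt_iff₀ hδ).1 (lt_of_lt_of_le (lt_add_one _) hρr)
    linarith
  set η : ℝ := θ / 2 + Complex.arg w with hη
  have hηle : |η| ≤ η₀ := by
    refine (abs_add_le _ _).trans ?_
    rw [abs_div, abs_two]
    linarith
  have hm := growthDirection_exp (by linarith : 5 * η₀ ≤ Real.pi / 2) hηle
  set m := Complex.exp (η * Complex.I) with hm'
  have hline : line T m (T + ρ * ‖w‖) = t := by
    have hww : (‖w‖ : ℂ) * Complex.exp (Complex.arg w * Complex.I) = w :=
      Complex.norm_mul_exp_arg_mul_I w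
    have : ((ρ * ‖w‖ : ℝ) : ℂ) * m = t * w := by
      have htw : t * w = t * (‖w‖ * Complex.exp (Complex.arg w * Complex.I)) := by rw [hww]
      rw [htw, ht, hm', hη]
      push_cast
      rw [add_mul, Complex.exp_add]
      ring
    rw [line, add_sub_cancel_left, this, hw]
    field_simp
    ring
  have hTle : T ≤ T + ρ * ‖w‖ := le_add_of_nonneg_right (by positivity)
  have hgr := hD.le_norm_sq_of_cone hm hκ hκ₁ hT.le le_rfl (hTσ T le_rfl).1 (hTσ T le_rfl).2
    (j := ‖amp 1 D T‖ ^ 2) (by positivity) (by simp [line, hq]) hTle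
  have hρσ : ρ ≤ T + ρ * ‖w‖ := by
    have := norm_line_le hm.norm_eq hT.le hTle
    rwa [hline, htn] at this
  rw [hline, ht, ofReal_sqrt_mul_exp_sq hr0.le] at hgr
  refine le_trans ?_ hgr
  have hr2 : r ^ 2 = ρ ^ 4 := by rw [← Real.sq_sqrt hr0.le]; ring
  rw [hr2]
  gcongr
  exact (growthConst_pos hκ (by positivity)).le

/-- On every ray in the sector `|arg x| < π / 5` a solution either grows or decays
superexponentially. -/
theorem IsSolution.growth_or_decay {a b : ℂ} {ψ : ℂ → ℂ} (h : IsSolution a b ψ) {θ : ℝ}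
    (hθ : |θ| < Real.pi / 5) :
    (∃ c > 0, ∃ R > 0, ∀ r : ℝ, R ≤ r → c * r ^ 2 ≤ ‖ψ (r * Complex.exp (θ * Complex.I))‖ ^ 2) ∨
    ∃ C, ∃ c > 0, ∃ R > 0, ∀ r : ℝ, R ≤ r →
      ‖ψ (r * Complex.exp (θ * Complex.I))‖ ^ 2 ≤ C * Real.exp (-(c * Real.sqrt r ^ 5)) := by
  set η₀ : ℝ := |θ| / 2 with hη₀
  obtain ⟨hκ, hκ₁⟩ := cos_five_mul_bounds (η₀ := η₀) (by positivity) (by linarith)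
  have hm := growthDirection_exp (η := θ / 2) (by linarith : 5 * η₀ ≤ Real.pi / 2)
    (by rw [abs_div, abs_two])
  set κ := Real.cos (5 * η₀)
  set m := Complex.exp ((θ / 2 : ℝ) * Complex.I) with hm'
  obtain ⟨T, hT, hTσ⟩ := exists_forall_le_mul a b hκ
  have hx : ∀ r : ℝ, 0 ≤ r → line 0 m (Real.sqrt r) ^ 2 = r * Complex.exp (θ * Complex.I) :=
    fun r hr => by simpa [line, hm'] using ofReal_sqrt_mul_exp_sq hr θ
  by_cases hcone : ∀ σ, T ≤ σ → ‖amp 1 ψ (line 0 m σ)‖ ^ 2 ≤ 4 * ‖amp (-1) ψ (line 0 m σ)‖ ^ 2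
  · right
    refine ⟨‖amp (-1) ψ (line 0 m T)‖ ^ 2 * Real.exp (4 * κ / 5 * T ^ 5), 4 * κ / 5, by positivity,
      max (T ^ 2) 1, by positivity, fun r hr => ?_⟩
    have hr1 : 1 ≤ r := (le_max_right _ _).trans hr
    have hσ : T ≤ Real.sqrt r := Real.le_sqrt_of_sq_le ((le_max_left _ _).trans hr)
    have hdec := h.amp_decay hm hκ hκ₁ le_rfl hT.le (hTσ T le_rfl).1 (hTσ T le_rfl).2 hcone hσ
    have hsub := norm_amp_sub ψ (line 0 m (Real.sqrt r))
    have htri := norm_sub_le (amp 1 ψ (line 0 m (Real.sqrt r)))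
      (amp (-1) ψ (line 0 m (Real.sqrt r)))
    have hc := hcone _ hσ
    rw [hsub] at htri
    have hn : 1 ≤ ‖line 0 m (Real.sqrt r)‖ := by
      have : ‖line 0 m (Real.sqrt r)‖ = Real.sqrt r := by simp [line, hm.norm_eq]
      rw [this]
      exact Real.one_le_sqrt.2 hr1
    rw [hx r (by linarith)] at htri
    rw [mul_assoc, ← Real.exp_add, add_comm (4 * κ / 5 * T ^ 5)]
    refine le_trans ?_ hdec
    set x := ‖amp 1 ψ (line 0 m (Real.sqrt r))‖
    set y := ‖amp (-1) ψ (line 0 m (Real.sqrt r))‖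
    set z := ‖ψ (r * Complex.exp (θ * Complex.I))‖
    have hxy : x ≤ 2 * y := le_of_sq_le_sq (by linarith) (by positivity)
    have h3 : 4 * z ≤ 4 * ‖line 0 m (Real.sqrt r)‖ ^ 3 * z := by
      have := one_le_pow₀ hn (n := 3)
      have hz : 0 ≤ z := norm_nonneg _
      nlinarith
    have hy : 0 ≤ y := norm_nonneg _
    exact pow_le_pow_left₀ (norm_nonneg _) (by linarith) 2
  · left
    push Not at hcone
    obtain ⟨σ₀, hσ₀, hJ⟩ := hcone
    have hσ0 : 0 < σ₀ := hT.trans_le hσ₀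
    refine ⟨_, growthConst_pos (σ₀ := σ₀) hκ (sub_pos.2 hJ), σ₀ ^ 2, by positivity, fun r hr => ?_⟩
    have hr0 : 0 ≤ r := (sq_nonneg _).trans hr
    have hgr := h.le_norm_sq_of_cone hm hκ hκ₁ le_rfl (hT.le.trans hσ₀) (hTσ σ₀ hσ₀).1
      (hTσ σ₀ hσ₀).2 (sub_pos.2 hJ) le_rfl (Real.le_sqrt_of_sq_le hr)
    have hr2 : Real.sqrt r ^ 4 = r ^ 2 := by
      nth_rw 2 [← Real.sq_sqrt hr0]; ring
    rwa [hx r hr0, hr2] at hgr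

/-- Solutions have order at most `5 / 2`. -/
theorem IsSolution.exists_norm_sq_le {a b : ℂ} {ψ : ℂ → ℂ} (h : IsSolution a b ψ) :
    ∃ C B, ∀ t : ℂ, 1 ≤ ‖t‖ → ‖ψ (t ^ 2)‖ ^ 2 ≤ C * Real.exp (B * ‖t‖ ^ 5) := by
  set N : ℂ → ℝ := fun t => ‖amp 1 ψ t‖ ^ 2 + ‖amp (-1) ψ t‖ ^ 2 with hN
  have hcont : Continuous N := by
    have : ∀ s : ℂ, s ^ 2 = 1 → Continuous (amp s ψ) := fun s hs =>
      continuous_iff_continuousAt.2 fun t => (h.hasDerivAt_amp hs t).continuousAt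
    exact ((this 1 (by norm_num)).norm.pow 2).add ((this (-1) (by norm_num)).norm.pow 2)
  obtain ⟨C, hC⟩ := (isCompact_sphere (0 : ℂ) 1).exists_bound_of_continuousOn hcont.continuousOn
  have hM := couplingBound_pos a b
  set M := couplingBound a b with hMdef
  refine ⟨C, (8 + 4 * M) / 5, fun t ht => ?_⟩
  have ht0 : t ≠ 0 := norm_ne_zero_iff.1 (by linarith)
  obtain ⟨m, hm, hmt⟩ : ∃ m : ℂ, ‖m‖ = 1 ∧ ‖t‖ * m = t :=
    ⟨t / ‖t‖, by rw [norm_div, Complex.norm_real, norm_norm, div_self (by linarith)],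
      mul_div_cancel₀ _ (by exact_mod_cast norm_ne_zero_iff.2 ht0)⟩
  have hline : ∀ σ : ℝ, line 0 m σ = σ * m := fun σ => by simp [line]
  have key := mul_exp_le_of_mul_le_deriv (J := fun σ => -N (line 0 m σ))
    (K := fun σ => (8 + 4 * M) / 5 * σ ^ 5) (k := fun σ => (8 + 4 * M) * σ ^ 4) (s₀ := 1)
    (fun σ _ => ((h.hasDerivAt_norm_sq_amp (s := 1) (by norm_num) 0 m σ).add
      (h.hasDerivAt_norm_sq_amp (s := -1) (by norm_num) 0 m σ)).fun_neg)
    (fun σ _ => ((hasDerivAt_pow 5 σ).const_mul _).congr_deriv (by norm_num; ring))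
    (fun σ hσ => ?_) ht
  · rw [hline ‖t‖, hmt] at key
    have hN1 : N (line 0 m 1) ≤ C := by
      refine (le_abs_self _).trans (hC _ ?_)
      simp [line, hm]
    have hN0 : 0 ≤ N (line 0 m 1) := by positivity
    have h1 : N t ≤ C * Real.exp ((8 + 4 * M) / 5 * ‖t‖ ^ 5) := by
      calc N t ≤ N (line 0 m 1) *
            Real.exp ((8 + 4 * M) / 5 * ‖t‖ ^ 5 - (8 + 4 * M) / 5 * 1 ^ 5) := by linarith
        _ ≤ _ := by
            gcongr
            · exact hN0.trans hN1
            · have : 0 ≤ (8 + 4 * M) / 5 := by positivity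
              linarith
    refine le_trans ?_ h1
    have hsub := norm_amp_sub ψ t
    have htri := norm_sub_le (amp 1 ψ t) (amp (-1) ψ t)
    rw [hsub] at htri
    have h3 := one_le_pow₀ ht (n := 3)
    have hz : 0 ≤ ‖ψ (t ^ 2)‖ := norm_nonneg _
    have h4 : 4 * ‖ψ (t ^ 2)‖ ≤ ‖amp 1 ψ t‖ + ‖amp (-1) ψ t‖ := by nlinarith
    have h5 := pow_le_pow_left₀ (by positivity) h4 2
    simp only [hN]
    nlinarith [sq_nonneg (‖amp 1 ψ t‖ - ‖amp (-1) ψ t‖), sq_nonneg ‖ψ (t ^ 2)‖]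
  · set τ := line 0 m σ with hτ
    have hτn : ‖τ‖ = σ := by rw [hτ, hline]; simp [hm, abs_of_nonneg (by linarith : (0:ℝ) ≤ σ)]
    have hb : ∀ s : ℂ, ‖s‖ = 1 → inner ℝ (amp s ψ τ) (s * (4 * (m * τ ^ 4)) * amp s ψ τ
        + m * ampErr a b s ψ τ) ≤ 4 * σ ^ 4 * ‖amp s ψ τ‖ ^ 2
          + ‖amp s ψ τ‖ * (M * (‖amp 1 ψ τ‖ + ‖amp (-1) ψ τ‖)) := fun s hs => by
      have he := norm_ampErr_le a b hs ψ (t := τ) (by rw [hτn]; exact hσ)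
      refine (real_inner_le_norm _ _).trans ?_
      calc ‖amp s ψ τ‖ * ‖s * (4 * (m * τ ^ 4)) * amp s ψ τ + m * ampErr a b s ψ τ‖
          ≤ ‖amp s ψ τ‖ * (4 * σ ^ 4 * ‖amp s ψ τ‖
            + M * (‖amp 1 ψ τ‖ + ‖amp (-1) ψ τ‖)) := by
            gcongr
            refine (norm_add_le _ _).trans (add_le_add (le_of_eq ?_) ?_)
            · simp [hs, hm, hτn]
            · rwa [norm_mul, hm, one_mul]
        _ = _ := by ring
    have h1 := hb 1 (by simp)
    have h2 := hb (-1) (by simp)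
    simp only [hN]
    have hσ4 := one_le_pow₀ hσ (n := 4)
    set x := ‖amp 1 ψ τ‖
    set y := ‖amp (-1) ψ τ‖
    have h3 : M * (2 * (x ^ 2 + y ^ 2)) ≤ σ ^ 4 * (M * (2 * (x ^ 2 + y ^ 2))) :=
      le_mul_of_one_le_left (by positivity) hσ4
    nlinarith [mul_nonneg hM.le (sq_nonneg (x - y))]

/-! ### Rotations and sectors -/

/-- The power `ω ^ j` for `j` modulo `5`. -/
noncomputable def rot (j : ZMod 5) : ℂ := ω ^ j.val

theorem ω_pow_five : ω ^ 5 = 1 := by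
  rw [ω, ← Complex.exp_nat_mul, Complex.exp_eq_one_iff]
  exact ⟨1, by push_cast; ring⟩

theorem ω_ne_zero : ω ≠ 0 := Complex.exp_ne_zero _

theorem rot_ne_zero (j : ZMod 5) : rot j ≠ 0 := pow_ne_zero _ ω_ne_zero

theorem rot_zero : rot 0 = 1 := by simp [rot]

theorem rot_one : rot 1 = ω := by
  rw [rot, show (1 : ZMod 5).val = 1 from rfl, pow_one]

theorem rot_natCast (n : ℕ) : rot n = ω ^ n := by
  rw [rot, ZMod.val_natCast, ← pow_mod_orderOf ω (n % 5), ← pow_mod_orderOf ω n,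
    Nat.mod_mod_of_dvd n (orderOf_dvd_of_pow_eq_one ω_pow_five)]

theorem rot_add (j k : ZMod 5) : rot (j + k) = rot j * rot k := by
  have : j + k = ((j.val + k.val : ℕ) : ZMod 5) := by simp
  rw [this, rot_natCast, pow_add, rot, rot]

theorem rot_neg (j : ZMod 5) : rot (-j) = (rot j)⁻¹ := by
  exact eq_inv_of_mul_eq_one_left (by rw [← rot_add, neg_add_cancel, rot_zero])

theorem rot_pow_five (j : ZMod 5) : rot j ^ 5 = 1 := by
  rw [rot, ← pow_mul, mul_comm, pow_mul, ω_pow_five, one_pow]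

theorem norm_rot (j : ZMod 5) : ‖rot j‖ = 1 :=
  Complex.norm_eq_one_of_pow_eq_one (rot_pow_five j) (by norm_num)

/-- The potential is quasi-homogeneous, so rotations of the variable by fifth roots of unity map
solutions to solutions for rotated parameters. -/
theorem IsSolution.comp_mul {a b ζ : ℂ} {ψ : ℂ → ℂ} (h : IsSolution a b ψ) (hζ : ζ ^ 5 = 1) :
    IsSolution (ζ ^ 3 * a) (ζ ^ 2 * b) (fun x => ψ (ζ * x)) := by
  have hm : ∀ x, HasDerivAt (fun x => ζ * x) ζ x := fun x => by
    simpa using (hasDerivAt_id x).const_mul ζ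
  refine isSolution_of_hasDerivAt (ψ' := fun x => ζ * deriv ψ (ζ * x))
    (fun x => ((h.hasDerivAt _).comp x (hm x)).congr_deriv (mul_comm _ _))
    fun x => (((h.hasDerivAt_deriv _).comp x (hm x)).const_mul ζ).congr_deriv ?_
  simp only [potential]
  linear_combination 4 * x ^ 3 * ψ (ζ * x) * hζ

theorem IsSolution.comp_rot {a b : ℂ} {ψ : ℂ → ℂ} (h : IsSolution a b ψ) (j : ZMod 5) :
    IsSolution (rot j ^ 3 * a) (rot j ^ 2 * b) (fun x => ψ (rot j * x)) :=
  h.comp_mul (rot_pow_five j)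

theorem IsSolution.comp_rot_neg {a b : ℂ} {ψ : ℂ → ℂ} {j : ZMod 5}
    (h : IsSolution (rot j ^ 3 * a) (rot j ^ 2 * b) ψ) :
    IsSolution a b (fun x => ψ (rot (-j) * x)) := by
  have := h.comp_rot (-j)
  have h1 := rot_ne_zero j
  rwa [rot_neg, inv_pow, inv_pow, inv_mul_cancel_left₀ (pow_ne_zero _ h1),
    inv_mul_cancel_left₀ (pow_ne_zero _ h1), ← rot_neg] at this

theorem wr_comp_mul {a b ζ : ℂ} {φ χ : ℂ → ℂ} (hφ : IsSolution a b φ) (hχ : IsSolution a b χ) :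
    wr (fun x => φ (ζ * x)) (fun x => χ (ζ * x)) = ζ * wr φ χ := by
  have hm : HasDerivAt (fun x => ζ * x) ζ 0 := by
    simpa using (hasDerivAt_id (0 : ℂ)).const_mul ζ
  have h1 := (HasDerivAt.comp (0 : ℂ) (hφ.hasDerivAt (ζ * 0)) hm).deriv
  have h2 := (HasDerivAt.comp (0 : ℂ) (hχ.hasDerivAt (ζ * 0)) hm).deriv
  simp only [Function.comp_def, mul_zero] at h1 h2
  simp only [wr, h1, h2, mul_zero]
  ring

theorem IsSolutionBasis.comp_rot {a b : ℂ} {φ χ : ℂ → ℂ} (h : IsSolutionBasis a b φ χ)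
    (j : ZMod 5) : IsSolutionBasis (rot j ^ 3 * a) (rot j ^ 2 * b) (fun x => φ (rot j * x))
      (fun x => χ (rot j * x)) := by
  obtain ⟨hφ, hχ, hw⟩ := isSolutionBasis_iff.1 h
  exact isSolutionBasis_iff.2 ⟨hφ.comp_rot j, hχ.comp_rot j,
    by rw [wr_comp_mul hφ hχ]; exact mul_ne_zero (rot_ne_zero j) hw⟩

/-- The filter of neighbourhoods of infinity in a proper subsector. -/
noncomputable def sectorFilter (k : ZMod 5) (ε : ℝ) : Filter ℂ :=
  Bornology.cobounded ℂ ⊓ 𝓟 (sector k ε)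

theorem sectorFilter_anti (k : ZMod 5) {ε ε' : ℝ} (h : ε ≤ ε') :
    sectorFilter k ε' ≤ sectorFilter k ε :=
  inf_le_inf_left _ <| principal_mono.2 fun x hx =>
    lt_of_lt_of_le (show |Complex.arg (x / ω ^ k.val)| < Real.pi / 5 - ε' from hx) (by linarith)

theorem tendsto_rot_mul (j k : ZMod 5) (ε : ℝ) :
    Tendsto (fun x => rot j * x) (sectorFilter k ε) (sectorFilter (j + k) ε) := by
  refine (Filter.tendsto_mul_left_cobounded (rot_ne_zero j)).inf (tendsto_principal_principal.2 ?_)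
  intro x hx
  have : rot j * x / rot (j + k) = x / rot k := by
    rw [rot_add, mul_div_mul_left _ _ (rot_ne_zero j)]
  change |Complex.arg (rot j * x / rot (j + k))| < _
  rw [this]
  exact hx

/-- Rays tend to infinity in the subsectors that contain them. -/
theorem tendsto_ray (k : ZMod 5) {ε θ : ℝ} (hε : 0 ≤ ε) (hθ : |θ| < Real.pi / 5 - ε) :
    Tendsto (fun r : ℝ => rot k * (r * Complex.exp (θ * Complex.I))) atTop (sectorFilter k ε) := by
  refine tendsto_inf.2 ⟨tendsto_norm_atTop_iff_cobounded.1 ?_, tendsto_principal.2 ?_⟩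
  · simp only [norm_mul, norm_rot, Complex.norm_exp_ofReal_mul_I, one_mul, mul_one,
      Complex.norm_real]
    exact tendsto_norm_atTop_atTop
  · filter_upwards [eventually_gt_atTop 0] with r hr
    change |Complex.arg (rot k * (r * Complex.exp (θ * Complex.I)) / rot k)| < _
    have hπ := Real.pi_pos
    have := abs_lt.1 hθ
    rwa [mul_div_cancel_left₀ _ (rot_ne_zero k), Complex.arg_real_mul _ hr, Complex.arg_exp_mul_I,
      toIocMod_eq_self _ |>.2 ⟨by linarith, by linarith⟩]

theorem sectorFilter_neBot (k : ZMod 5) {ε : ℝ} (hε : 0 ≤ ε) (hε' : ε < Real.pi / 5) :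
    (sectorFilter k ε).NeBot :=
  (tendsto_ray k (θ := 0) hε (by simpa using hε')).neBot

/-- To verify an eventual property in a subsector around the positive axis, it suffices to consider
points in polar coordinates. -/
theorem eventually_sectorFilter_zero {p : ℂ → Prop} {ε R : ℝ}
    (h : ∀ r : ℝ, R ≤ r → ∀ θ : ℝ, |θ| ≤ Real.pi / 5 - ε → p (r * Complex.exp (θ * Complex.I))) :
    ∀ᶠ x in sectorFilter 0 ε, p x := by
  have h1 : ∀ᶠ x in sectorFilter 0 ε, R ≤ ‖x‖ :=
    (tendsto_norm_cobounded_atTop.mono_left inf_le_left).eventually_ge_atTop R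
  have h2 : ∀ᶠ x in sectorFilter 0 ε, x ∈ sector 0 ε :=
    eventually_inf_principal.2 (Eventually.of_forall fun _ hx => hx)
  filter_upwards [h1, h2] with x hx hs
  have := h ‖x‖ hx (Complex.arg x) (by
    have hs' : |Complex.arg (x / rot 0)| < Real.pi / 5 - ε := hs
    rw [rot_zero, div_one] at hs'
    exact hs'.le)
  rwa [Complex.norm_mul_exp_arg_mul_I] at this

/-! ### Quotients of solutions -/

theorem IsSolution.hasDerivAt_div {a b : ℂ} {φ D : ℂ → ℂ} (hφ : IsSolution a b φ)
    (hD : IsSolution a b D) {x : ℂ} (hx : D x ≠ 0) :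
    HasDerivAt (fun x => φ x / D x) (wr D φ / D x ^ 2) x := by
  refine ((hφ.hasDerivAt x).div (hD.hasDerivAt x) hx).congr_deriv ?_
  rw [← wr_eq hD hφ x]
  ring

theorem ne_zero_of_growth {D : ℂ} {c r R : ℝ} (hc : 0 < c) (hR : 0 < R) (hr : R ≤ r)
    (h : c * r ^ 2 ≤ ‖D‖ ^ 2) : D ≠ 0 := by
  rintro rfl
  have : 0 < c * r ^ 2 := by have := hR.trans_le hr; positivity
  simp at h
  linarith

theorem norm_wr_div_le {W D : ℂ} {c r R : ℝ} (hc : 0 < c) (hR : 0 < R) (hr : R ≤ r)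
    (h : c * r ^ 2 ≤ ‖D‖ ^ 2) : ‖W / D ^ 2‖ ≤ ‖W‖ / (c * r ^ 2) := by
  have hr0 := hR.trans_le hr
  rw [norm_div, norm_pow]
  gcongr

/-- The derivative of `φ / D` is a constant multiple of `1 / D ^ 2`, hence integrable along a ray on
which `D` grows. -/
theorem IsSolution.exists_tendsto_div_ray {a b : ℂ} {φ D : ℂ → ℂ} (hφ : IsSolution a b φ)
    (hD : IsSolution a b D) {c R θ : ℝ} (hc : 0 < c) (hR : 0 < R)
    (h : ∀ r : ℝ, R ≤ r → c * r ^ 2 ≤ ‖D (r * Complex.exp (θ * Complex.I))‖ ^ 2) :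
    ∃ l, Tendsto (fun r : ℝ => φ (r * Complex.exp (θ * Complex.I)) /
      D (r * Complex.exp (θ * Complex.I))) atTop (𝓝 l) := by
  set e := Complex.exp (θ * Complex.I) with he
  have hen : ‖e‖ = 1 := Complex.norm_exp_ofReal_mul_I θ
  have hne : ∀ r : ℝ, R ≤ r → D (r * e) ≠ 0 := fun r hr =>
    ne_zero_of_growth hc hR hr (h r hr)
  have hl : ∀ r : ℝ, HasDerivAt (fun r : ℝ => (r : ℂ) * e) e r := fun r => by
    simpa using (Complex.ofRealCLM.hasDerivAt (x := r)).mul_const e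
  have hder : ∀ r ∈ Set.Ioi R, HasDerivAt (fun r : ℝ => φ (r * e) / D (r * e))
      (wr D φ / D (r * e) ^ 2 * e) r := fun r hr =>
    (hφ.hasDerivAt_div hD (hne r (le_of_lt hr))).comp_of_eq r (hl r) rfl
  have hint : MeasureTheory.IntegrableOn (fun r : ℝ => wr D φ / D (r * e) ^ 2 * e)
      (Set.Ioi R) := by
    refine MeasureTheory.Integrable.mono'
      ((integrableOn_Ioi_rpow_of_lt (by norm_num : (-2 : ℝ) < -1) hR).const_mul
        (‖wr D φ‖ / c)) ?_ ?_
    · refine ContinuousOn.aestronglyMeasurable (fun r hr => ?_) measurableSet_Ioi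
      have hDc : ContinuousAt (fun r : ℝ => D (r * e)) r :=
        ContinuousAt.comp_of_eq (hD.1 _).continuousAt (hl r).continuousAt rfl
      exact ((continuousAt_const.div (hDc.pow 2) (pow_ne_zero 2 (hne r (le_of_lt hr)))).mul
        continuousAt_const).continuousWithinAt
    · refine (MeasureTheory.ae_restrict_iff' measurableSet_Ioi).2
        (Eventually.of_forall fun r hr => ?_)
      rw [norm_mul, hen, mul_one]
      refine (norm_wr_div_le hc hR (le_of_lt hr) (h r (le_of_lt hr))).trans (le_of_eq ?_)
      have hr0 : 0 < r := hR.trans hr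
      rw [Real.rpow_neg hr0.le, div_mul_eq_div_div]
      norm_cast
  exact ⟨_, MeasureTheory.tendsto_limUnder_of_hasDerivAt_of_integrableOn_Ioi hder hint⟩

/-- In a subsector some solution `D` grows, and then `φ / D` converges for all solutions `φ`: it
converges along rays by `IsSolution.exists_tendsto_div_ray`, and on arcs the oscillation of the
quotient is controlled by the length of the arc times the bound for `1 / D ^ 2`. -/
theorem exists_dominant_zero (a b : ℂ) {ε : ℝ} (hε : 0 < ε) :
    ∃ D, IsSolution a b D ∧ (∀ᶠ x in sectorFilter 0 ε, D x ≠ 0) ∧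
      ∀ φ, IsSolution a b φ → ∃ l, Tendsto (fun x => φ x / D x) (sectorFilter 0 ε) (𝓝 l) := by
  have hπ := Real.pi_pos
  wlog hε' : ε < Real.pi / 5 generalizing ε
  · obtain ⟨D, hD, h1, h2⟩ := this (ε := Real.pi / 10) (by linarith) (by linarith)
    have hle := sectorFilter_anti 0 (by linarith : Real.pi / 10 ≤ ε)
    exact ⟨D, hD, hle h1, fun φ hφ => (h2 φ hφ).imp fun l hl => hl.mono_left hle⟩
  obtain ⟨D, hD, c, hc, R, hR, hgr⟩ := exists_growing a b hε hε'
  refine ⟨D, hD, eventually_sectorFilter_zero fun r hr θ hθ =>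
    ne_zero_of_growth hc hR hr (hgr r hr θ hθ), fun φ hφ => ?_⟩
  obtain ⟨l, hl⟩ := hφ.exists_tendsto_div_ray hD (θ := 0) hc hR fun r hr =>
    hgr r hr 0 (by simpa using hε'.le)
  refine ⟨l, Metric.tendsto_nhds.2 fun δ hδ => ?_⟩
  have harc : Tendsto (fun r : ℝ => ‖wr D φ‖ / c * r⁻¹ * Real.pi) atTop (𝓝 0) := by
    simpa using (tendsto_inv_atTop_zero.const_mul (‖wr D φ‖ / c)).mul_const Real.pi
  obtain ⟨R₁, hR₁⟩ := eventually_atTop.1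
    ((Metric.tendsto_nhds.1 hl (δ / 2) (by linarith)).and
      (harc.eventually_lt_const (by linarith : 0 < δ / 2)))
  refine eventually_sectorFilter_zero (R := max R R₁) fun r hr θ hθ => ?_
  have hrR := (le_max_left _ _).trans hr
  have hr0 : 0 < r := hR.trans_le hrR
  obtain ⟨h1, h2⟩ := hR₁ r ((le_max_right _ _).trans hr)
  set s : Set ℝ := Set.Icc (-(Real.pi / 5 - ε)) (Real.pi / 5 - ε) with hs
  have hmem : ∀ {θ}, |θ| ≤ Real.pi / 5 - ε ↔ θ ∈ s := abs_le
  have hder : ∀ θ : ℝ, HasDerivAt (fun θ : ℝ => (r : ℂ) * Complex.exp (θ * Complex.I))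
      (r * (Complex.exp (θ * Complex.I) * Complex.I)) θ := fun θ => by
    have : HasDerivAt (fun θ : ℝ => (θ : ℂ) * Complex.I) Complex.I θ := by
      simpa using (Complex.ofRealCLM.hasDerivAt (x := θ)).mul_const Complex.I
    exact this.cexp.const_mul (r : ℂ)
  have hle := Convex.norm_image_sub_le_of_norm_hasDerivWithin_le (𝕜 := ℝ)
    (f := fun θ : ℝ => φ (r * Complex.exp (θ * Complex.I)) / D (r * Complex.exp (θ * Complex.I)))
    (s := s) (x := 0) (y := θ) (C := ‖wr D φ‖ / c * r⁻¹)
    (fun θ hθ => ((hφ.hasDerivAt_div hD (ne_zero_of_growth hc hR hrR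
      (hgr r hrR θ (hmem.2 hθ)))).comp_of_eq θ (hder θ) rfl).hasDerivWithinAt)
    (fun θ hθ => ?_) (convex_Icc _ _) (hmem.1 (by simpa using hε'.le)) (hmem.1 hθ)
  · have hθπ : ‖θ - 0‖ ≤ Real.pi := by
      rw [sub_zero, Real.norm_eq_abs]; linarith
    have h3 := hle.trans (mul_le_mul_of_nonneg_left hθπ (by positivity))
    rw [← dist_eq_norm] at h3
    calc _ ≤ _ := dist_triangle _ _ _
      _ < δ / 2 + δ / 2 := add_lt_add_of_lt_of_le (h3.trans_lt h2) h1.le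
      _ = δ := by ring
  · rw [norm_mul, norm_mul, norm_mul, Complex.norm_exp_ofReal_mul_I, Complex.norm_I,
      Complex.norm_real, Real.norm_of_nonneg hr0.le]
    refine (mul_le_mul_of_nonneg_right (norm_wr_div_le hc hR hrR (hgr r hrR θ (hmem.2 hθ)))
      (by positivity)).trans (le_of_eq ?_)
    field_simp

theorem exists_dominant (a b : ℂ) (k : ZMod 5) {ε : ℝ} (hε : 0 < ε) :
    ∃ D, IsSolution a b D ∧ (∀ᶠ x in sectorFilter k ε, D x ≠ 0) ∧
      ∀ φ, IsSolution a b φ → ∃ l, Tendsto (fun x => φ x / D x) (sectorFilter k ε) (𝓝 l) := by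
  obtain ⟨D, hD, h1, h2⟩ := exists_dominant_zero (rot k ^ 3 * a) (rot k ^ 2 * b) hε
  have ht : Tendsto (fun x => rot (-k) * x) (sectorFilter k ε) (sectorFilter 0 ε) := by
    simpa using tendsto_rot_mul (-k) k ε
  refine ⟨_, hD.comp_rot_neg, ht.eventually h1, fun φ hφ => ?_⟩
  obtain ⟨l, hl⟩ := h2 _ (hφ.comp_rot k)
  refine ⟨l, (hl.comp ht).congr fun x => ?_⟩
  simp only [Function.comp]
  rw [rot_neg, mul_inv_cancel_left₀ (rot_ne_zero k)]

/-! ### Recessive solutions -/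

/-- The nonzero solutions that are negligible, in the `k`-th sector, against all solutions that are
not proportional to them. -/
structure IsRecessive (a b : ℂ) (k : ZMod 5) (ψ : ℂ → ℂ) : Prop where
  isSolution : IsSolution a b ψ
  ne_zero : ψ ≠ 0
  tendsto : ∀ χ, IsSolution a b χ → wr ψ χ ≠ 0 → ∀ ε : ℝ, 0 < ε →
    (∀ᶠ x in sectorFilter k ε, χ x ≠ 0) ∧ Tendsto (fun x => ψ x / χ x) (sectorFilter k ε) (𝓝 0)

theorem IsSolution.wr_ne_zero_or {a b : ℂ} {φ χ ψ : ℂ → ℂ} (h : IsSolutionBasis a b φ χ)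
    (hψ : IsSolution a b ψ) (hψ0 : ψ ≠ 0) : wr ψ φ ≠ 0 ∨ wr ψ χ ≠ 0 := by
  obtain ⟨hφ, hχ, hw⟩ := isSolutionBasis_iff.1 h
  by_contra! hc
  exact hψ0 (hψ.eq_zero hχ hφ hw hc.2 (by rw [wr_swap, hc.1, neg_zero]))

theorem IsSolution.exists_wr_ne_zero {a b : ℂ} {ψ : ℂ → ℂ}
    (hψ : IsSolution a b ψ) (hψ0 : ψ ≠ 0) : ∃ χ, IsSolution a b χ ∧ wr ψ χ ≠ 0 := by
  obtain ⟨φ, χ, h⟩ := exists_isSolutionBasis a b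
  rcases hψ.wr_ne_zero_or h hψ0 with h' | h'
  · exact ⟨φ, h.1, h'⟩
  · exact ⟨χ, h.2.1, h'⟩

/-- If `φ / D → l`, then `φ - l D` is recessive. -/
theorem exists_isRecessive (a b : ℂ) (k : ZMod 5) : ∃ ψ, IsRecessive a b k ψ := by
  have hπ := Real.pi_pos
  have hne := sectorFilter_neBot k (ε := Real.pi / 10) (by linarith) (by linarith)
  obtain ⟨D₁, hD₁, hD₁0, hlim₁⟩ := exists_dominant a b k (ε := Real.pi / 10) (by linarith)
  have hD₁ne : D₁ ≠ 0 := by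
    rintro rfl
    obtain ⟨x, hx⟩ := hD₁0.exists
    exact hx rfl
  obtain ⟨φ, hφ, hwr⟩ := hD₁.exists_wr_ne_zero hD₁ne
  obtain ⟨l, hl⟩ := hlim₁ φ hφ
  set ψ : ℂ → ℂ := fun x => 1 * φ x + -l * D₁ x with hψdef
  have hψ : IsSolution a b ψ := hφ.lincomb hD₁ 1 (-l)
  have hwrψ : wr D₁ ψ = wr D₁ φ := by
    rw [wr, wr, hψdef, deriv_lincomb hφ hD₁]; ring
  have hψD₁ : Tendsto (fun x => ψ x / D₁ x) (sectorFilter k (Real.pi / 10)) (𝓝 0) := by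
    have := hl.sub_const l
    rw [sub_self] at this
    refine this.congr' ?_
    filter_upwards [hD₁0] with x hx
    rw [hψdef]
    field_simp
    ring
  refine ⟨ψ, hψ, ?_, fun χ hχ hw ε hε => ?_⟩
  · intro h0
    apply hwr
    rw [← hwrψ, h0]
    simp [wr]
  -- for `ε ≤ π / 10` the subsector contains the one on which `ψ / D₁` is known to tend to `0`
  wlog hε' : ε ≤ Real.pi / 10 generalizing ε
  · obtain ⟨h1, h2⟩ := this (Real.pi / 10) (by linarith) le_rfl
    have hle := sectorFilter_anti k (not_le.1 hε').le
    exact ⟨hle h1, h2.mono_left hle⟩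
  have hle := sectorFilter_anti k hε'
  have hneε : (sectorFilter k ε).NeBot := hne.mono hle
  obtain ⟨D, hD, hD0, hlim⟩ := exists_dominant a b k hε
  obtain ⟨l', hl'⟩ := hlim ψ hψ
  have hψD : Tendsto (fun x => ψ x / D x) (sectorFilter k ε) (𝓝 0) := by
    obtain ⟨m, hm⟩ := hlim D₁ hD₁
    have h0 := hψD₁.mul (hm.mono_left hle)
    rw [zero_mul] at h0
    have : l' = 0 := by
      refine tendsto_nhds_unique (hl'.mono_left hle) (h0.congr' ?_)
      filter_upwards [hD₁0] with x hx
      rw [div_mul_div_cancel₀ hx]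
    rwa [this] at hl'
  have hχD : Tendsto (fun x => wr ψ D * (χ x / D x)) (sectorFilter k ε) (𝓝 (wr ψ χ)) := by
    have := (hψD.const_mul (wr χ D)).add_const (wr ψ χ)
    rw [mul_zero, zero_add] at this
    refine this.congr' ?_
    filter_upwards [hD0] with x hx
    rw [← mul_div_assoc, ← mul_div_assoc, wr_mul_apply hχ hD hψ x]
    field_simp
  have hwD : wr ψ D ≠ 0 := fun h0 => by
    simp only [h0, zero_mul] at hχD
    exact hw (tendsto_nhds_unique hχD tendsto_const_nhds)
  have hχD' : ∀ᶠ x in sectorFilter k ε, χ x ≠ 0 := by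
    filter_upwards [hχD.eventually_ne hw] with x hx h0
    simp [h0] at hx
  refine ⟨hχD', ?_⟩
  have := (hψD.const_mul (wr ψ D)).div hχD hw
  rw [mul_zero, zero_div] at this
  refine this.congr' ?_
  filter_upwards [hχD', hD0] with x hx hx'
  simp only [Pi.div_apply]
  field_simp

/-- The recessive solutions of one sector are unique up to a factor. -/
theorem IsRecessive.of_wr_eq_zero {a b : ℂ} {k : ZMod 5} {ψ φ : ℂ → ℂ}
    (h : IsRecessive a b k ψ) (hφ : IsSolution a b φ) (hφ0 : φ ≠ 0) (hw : wr ψ φ = 0) :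
    IsRecessive a b k φ := by
  obtain ⟨χ₀, hχ₀, hw₀⟩ := h.isSolution.exists_wr_ne_zero h.ne_zero
  have hprop : ∀ x, φ x = wr φ χ₀ / wr ψ χ₀ * ψ x := fun x => by
    have := wr_mul_apply hφ hχ₀ h.isSolution x
    rw [hw, zero_mul, add_zero] at this
    rw [div_mul_eq_mul_div, ← this, mul_div_cancel_left₀ _ hw₀]
  set c := wr φ χ₀ / wr ψ χ₀
  refine ⟨hφ, hφ0, fun χ hχ hwχ ε hε => ?_⟩
  have hψχ : wr ψ χ ≠ 0 := fun h0 => hwχ <| by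
    have e : φ = fun x => c * ψ x + 0 * ψ x := funext fun x => by rw [hprop]; ring
    have e' : wr φ χ = c * wr ψ χ := by
      rw [wr, e, deriv_lincomb h.isSolution h.isSolution, wr]; ring
    rw [e', h0, mul_zero]
  obtain ⟨h1, h2⟩ := h.tendsto χ hχ hψχ ε hε
  refine ⟨h1, ?_⟩
  simpa [hprop, mul_div_assoc] using h2.const_mul c

/-! ### Asymptotic values -/

theorem tendsto_sphereQuot_infty {l : Filter ℂ} {φ χ : ℂ → ℂ} (hφ : ∀ᶠ x in l, φ x ≠ 0)
    (h : Tendsto (fun x => χ x / φ x) l (𝓝 0)) :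
    Tendsto (fun x => sphereQuot (φ x) (χ x)) l (𝓝 OnePoint.infty) := by
  refine OnePoint.hasBasis_nhds_infty.tendsto_right_iff.2 fun K hK => ?_
  obtain ⟨M, hM⟩ := hK.2.isBounded.exists_norm_le
  have hsmall : ∀ᶠ x in l, ‖χ x / φ x‖ < 1 / (|M| + 1) := by
    simpa using (h.norm).eventually_lt_const (by simp; positivity)
  filter_upwards [hφ, hsmall] with x hx hs
  by_cases h0 : χ x = 0
  · right; simp [sphereQuot, h0]
  · left
    refine ⟨φ x / χ x, fun hmem => ?_, by simp [sphereQuot, h0]⟩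
    have h1 := (hM _ hmem).trans (le_abs_self M)
    rw [norm_div] at h1 hs
    have hχ : 0 < ‖χ x‖ := norm_pos_iff.2 h0
    have hφ' : 0 < ‖φ x‖ := norm_pos_iff.2 hx
    rw [div_le_iff₀ hχ] at h1
    rw [div_lt_div_iff₀ hφ' (by positivity)] at hs
    linarith

theorem IsRecessive.tendsto_div {a b : ℂ} {k : ZMod 5} {φ χ ψ : ℂ → ℂ} (h : IsRecessive a b k ψ)
    (hφ : IsSolution a b φ) (hχ : IsSolution a b χ) (hw : wr ψ χ ≠ 0) {ε : ℝ} (hε : 0 < ε) :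
    Tendsto (fun x => φ x / χ x) (sectorFilter k ε) (𝓝 (wr ψ φ / wr ψ χ)) := by
  obtain ⟨h1, h2⟩ := h.tendsto χ hχ hw ε hε
  have := (h2.const_mul (wr φ χ / wr ψ χ)).add_const (wr ψ φ / wr ψ χ)
  rw [mul_zero, zero_add] at this
  refine this.congr' ?_
  filter_upwards [h1] with x hx
  have := wr_mul_apply hφ hχ h.isSolution x
  field_simp
  linear_combination -this

/-- The asymptotic value in a sector in terms of Wronskians with the recessive solution. -/
theorem IsRecessive.isAsymptoticValue {a b : ℂ} {k : ZMod 5} {φ χ ψ : ℂ → ℂ}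
    (h : IsRecessive a b k ψ) (hb : IsSolutionBasis a b φ χ) :
    IsAsymptoticValue φ χ k (sphereQuot (wr ψ φ) (wr ψ χ)) := by
  intro ε hε
  obtain ⟨hφ, hχ, -⟩ := isSolutionBasis_iff.1 hb
  by_cases hw : wr ψ χ = 0
  · have hw' := (h.isSolution.wr_ne_zero_or hb h.ne_zero).resolve_right (not_not.2 hw)
    have h1 := h.tendsto_div hχ hφ hw' hε
    rw [hw, zero_div] at h1
    rw [sphereQuot, if_pos hw]
    exact tendsto_sphereQuot_infty (h.tendsto φ hφ hw' ε hε).1 h1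
  · rw [sphereQuot, if_neg hw]
    refine ((OnePoint.continuous_coe.tendsto _).comp (h.tendsto_div hφ hχ hw hε)).congr' ?_
    filter_upwards [(h.tendsto χ hχ hw ε hε).1] with x hx
    simp [sphereQuot, hx]

theorem IsAsymptoticValue.unique {φ χ : ℂ → ℂ} {k : ZMod 5} {w w' : OnePoint ℂ}
    (h : IsAsymptoticValue φ χ k w) (h' : IsAsymptoticValue φ χ k w') : w = w' := by
  have hπ := Real.pi_pos
  have hne := sectorFilter_neBot k (ε := Real.pi / 10) (by linarith) (by linarith)
  exact tendsto_nhds_unique (l := sectorFilter k (Real.pi / 10)) (h _ (by linarith))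
    (h' _ (by linarith))

theorem IsAsymptoticValue.comp_rot {φ χ : ℂ → ℂ} {j k : ZMod 5} {w : OnePoint ℂ}
    (h : IsAsymptoticValue φ χ (j + k) w) :
    IsAsymptoticValue (fun x => φ (rot j * x)) (fun x => χ (rot j * x)) k w :=
  fun ε hε => (h ε hε).comp (tendsto_rot_mul j k ε)

/-! ### Recessive solutions of neighbouring sectors -/

/-- On the rays of its sector a recessive solution decays superexponentially: it cannot grow, since
then the quotients of the other solutions by it would stay bounded. -/
theorem IsRecessive.exists_decay {a b : ℂ} {k : ZMod 5} {ψ : ℂ → ℂ} (h : IsRecessive a b k ψ)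
    {θ : ℝ} (hθ : |θ| < Real.pi / 5) :
    ∃ C, ∃ c > 0, ∃ R > 0, ∀ r : ℝ, R ≤ r →
      ‖ψ (rot k * (r * Complex.exp (θ * Complex.I)))‖ ^ 2
        ≤ C * Real.exp (-(c * Real.sqrt r ^ 5)) := by
  have hψ' := h.isSolution.comp_rot k
  refine (hψ'.growth_or_decay hθ).resolve_left ?_
  rintro ⟨c, hc, R, hR, hgr⟩
  obtain ⟨χ, hχ, hw⟩ := h.isSolution.exists_wr_ne_zero h.ne_zero
  obtain ⟨l, hl⟩ := (hχ.comp_rot k).exists_tendsto_div_ray hψ' hc hR hgr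
  set ε := (Real.pi / 5 - |θ|) / 2 with hε
  obtain ⟨h1, h2⟩ := h.tendsto χ hχ hw ε (by linarith)
  have hray := tendsto_ray k (ε := ε) (θ := θ) (by linarith) (by linarith)
  have hmul := (h2.comp hray).mul hl
  rw [zero_mul] at hmul
  refine zero_ne_one (tendsto_nhds_unique hmul (tendsto_const_nhds.congr' ?_))
  filter_upwards [hray.eventually h1, eventually_ge_atTop R] with r hr hrR
  have := ne_zero_of_growth hc hR hrR (hgr r hrR)
  simp only [Function.comp]
  rw [div_mul_div_cancel₀ hr, div_self this]

theorem IsRecessive.exists_norm_le {a b : ℂ} {k : ZMod 5} {ψ : ℂ → ℂ} (h : IsRecessive a b k ψ)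
    {θ : ℝ} (hθ : |θ| < Real.pi / 5) :
    ∃ C, ∀ r : ℝ, 0 ≤ r → ‖ψ (rot k * (r * Complex.exp (θ * Complex.I)))‖ ≤ C := by
  obtain ⟨C, c, hc, R, hR, hdec⟩ := h.exists_decay hθ
  have hcont : Continuous fun r : ℝ => ψ (rot k * (r * Complex.exp (θ * Complex.I))) :=
    h.isSolution.1.continuous.comp (by fun_prop)
  obtain ⟨C', hC'⟩ := (isCompact_Icc (a := (0 : ℝ)) (b := R)).exists_bound_of_continuousOn
    hcont.continuousOn
  refine ⟨max C' (1 + |C|), fun r hr => ?_⟩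
  rcases le_total r R with hrR | hrR
  · exact (hC' r ⟨hr, hrR⟩).trans (le_max_left _ _)
  · refine le_trans ?_ (le_max_right _ _)
    have h1 : C * Real.exp (-(c * Real.sqrt r ^ 5)) ≤ |C| * 1 := by
      refine mul_le_mul (le_abs_self C) (Real.exp_le_one_iff.2 ?_) (Real.exp_pos _).le
        (abs_nonneg C)
      simp only [Left.neg_nonpos_iff]
      positivity
    nlinarith [hdec r hrR, sq_nonneg (‖ψ (rot k * (r * Complex.exp (θ * Complex.I)))‖ - 1)]

theorem cpow_half_polar {r φ : ℝ} (hr : 0 ≤ r) (h₁ : -Real.pi < φ) (h₂ : φ ≤ Real.pi) :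
    ((r : ℂ) * Complex.exp (φ * Complex.I)) ^ (1 / 2 : ℂ)
      = Real.sqrt r * Complex.exp ((φ / 2 : ℝ) * Complex.I) := by
  rcases hr.eq_or_lt with rfl | hr
  · simp
  · have h0 : (r : ℂ) * Complex.exp (φ * Complex.I) ≠ 0 :=
      mul_ne_zero (by exact_mod_cast hr.ne') (Complex.exp_ne_zero _)
    rw [Complex.cpow_def_of_ne_zero h0, Complex.log_ofReal_mul hr (Complex.exp_ne_zero _),
      Complex.log_exp (by simpa using h₁) (by simpa using h₂), add_mul, Complex.exp_add,
      Real.sqrt_eq_rpow, Real.rpow_def_of_pos hr]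
    push_cast
    ring_nf

theorem cpow_half_sq (z : ℂ) : (z ^ (1 / 2 : ℂ)) ^ 2 = z := by
  rw [← Complex.cpow_nat_mul]
  norm_num

theorem norm_cpow_half (z : ℂ) : ‖z ^ (1 / 2 : ℂ)‖ = Real.sqrt ‖z‖ := by
  rw [← Real.sqrt_sq (norm_nonneg (z ^ (1 / 2 : ℂ))), ← norm_pow, cpow_half_sq]

/-- A solution composed with a square root has order at most `5 / 4` in the half plane. -/
theorem IsSolution.isBigO_comp_cpow_half {a b ζ : ℂ} {ψ : ℂ → ℂ} (h : IsSolution a b ψ)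
    (hζ : ‖ζ‖ = 1) (l : Filter ℂ) : ∃ c < (2 : ℝ), ∃ B : ℝ,
      (fun z : ℂ => ψ (ζ * z ^ (1 / 2 : ℂ))) =O[Bornology.cobounded ℂ ⊓ l]
        fun z => Real.exp (B * ‖z‖ ^ c) := by
  obtain ⟨C, B, hCB⟩ := h.exists_norm_sq_le
  refine ⟨5 / 4, by norm_num, |B|, Asymptotics.IsBigO.of_bound (1 + |C|) ?_⟩
  have h1 : ∀ᶠ z in Bornology.cobounded ℂ ⊓ l, 1 ≤ ‖z‖ :=
    (tendsto_norm_cobounded_atTop.mono_left inf_le_left).eventually_ge_atTop 1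
  filter_upwards [h1] with z hz
  set x := ζ * z ^ (1 / 2 : ℂ) with hx
  set t := x ^ (1 / 2 : ℂ) with ht
  have htn : ‖t‖ = ‖z‖ ^ (1 / 4 : ℝ) := by
    rw [ht, norm_cpow_half, hx, norm_mul, hζ, one_mul, norm_cpow_half, Real.sqrt_eq_rpow,
      Real.sqrt_eq_rpow, ← Real.rpow_mul (norm_nonneg z)]
    norm_num
  have ht1 : 1 ≤ ‖t‖ := by rw [htn]; exact Real.one_le_rpow hz (by norm_num)
  have ht5 : ‖t‖ ^ 5 = ‖z‖ ^ (5 / 4 : ℝ) := by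
    rw [htn, ← Real.rpow_natCast, ← Real.rpow_mul (norm_nonneg z)]
    norm_num
  have hb := hCB t ht1
  rw [ht, cpow_half_sq, ← ht, ht5] at hb
  rw [Real.norm_of_nonneg (Real.exp_pos _).le]
  set E := ‖z‖ ^ (5 / 4 : ℝ)
  have hE : 0 ≤ E := by positivity
  have h2 : C * Real.exp (B * E) ≤ |C| * Real.exp (|B| * E) := by
    refine mul_le_mul (le_abs_self C) (Real.exp_le_exp.2 ?_) (Real.exp_pos _).le (abs_nonneg C)
    gcongr
    exact le_abs_self B
  have h3 : 1 ≤ Real.exp (|B| * E) := Real.one_le_exp (by positivity)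
  nlinarith [sq_nonneg (‖ψ x‖ - 1)]

/-- The decay of `exp (- c x ^ (5 / 4))` beats the growth of all powers of `exp x`. -/
theorem tendsto_exp_pow_mul_decay (n : ℕ) {c : ℝ} (hc : 0 < c) :
    Tendsto (fun x : ℝ => (Real.exp x ^ n) ^ 2 *
      Real.exp (-(c * Real.sqrt (Real.sqrt x) ^ 5))) atTop (𝓝 0) := by
  have hu : Tendsto (fun x : ℝ => Real.sqrt (Real.sqrt x)) atTop atTop :=
    Real.tendsto_sqrt_atTop.comp Real.tendsto_sqrt_atTop
  have h1 : Tendsto (fun u : ℝ => u ^ 4 * (2 * n - c * u)) atTop atBot := by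
    refine (tendsto_pow_atTop (by norm_num)).atTop_mul_atBot₀ ?_
    exact tendsto_atBot_add_const_left _ _ (tendsto_neg_atTop_atBot.comp
      (tendsto_id.const_mul_atTop hc))
  refine (Real.tendsto_exp_atBot.comp (h1.comp hu)).congr' ?_
  filter_upwards [eventually_ge_atTop 0] with x hx
  simp only [Function.comp]
  rw [← pow_mul, ← Real.exp_nat_mul, ← Real.exp_add]
  congr 1
  have hx4 : Real.sqrt (Real.sqrt x) ^ 4 = x := by
    rw [show (4 : ℕ) = 2 * 2 from rfl, pow_mul, Real.sq_sqrt (Real.sqrt_nonneg x), Real.sq_sqrt hx]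
  push_cast
  linear_combination (2 * n) * hx4

/-- No solution is recessive in two neighbouring sectors. Up to a rotation these are the sectors `0` and
`1`. The rays `arg x = π / 20, 6 π / 20` and
`11 π / 20`, the first in the `0`-th and the others in the first sector, are the images of the rays
`arg z = - π / 2, 0, π / 2` under `z ↦ exp (3 π i / 10) z ^ (1 / 2)`. Composed with this map, such a
solution would be of order less than `2` in the right half plane, bounded on the boundary and
superexponentially small on the positive axis, so the Phragmén–Lindelöf principle applies. -/
theorem IsRecessive.not_isRecessive_add_one {a b : ℂ} {k : ZMod 5} {ψ : ℂ → ℂ}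
    (h : IsRecessive a b k ψ) : ¬ IsRecessive a b (k + 1) ψ := by
  intro h'
  have hπ := Real.pi_pos
  set ζ : ℂ := rot k * Complex.exp ((3 * Real.pi / 10 : ℝ) * Complex.I) with hζ
  have hζn : ‖ζ‖ = 1 := by rw [hζ, norm_mul, norm_rot, Complex.norm_exp_ofReal_mul_I, one_mul]
  have hζk : ∀ (ρ φ : ℝ), ζ * (ρ * Complex.exp (φ * Complex.I))
      = rot k * (ρ * Complex.exp ((3 * Real.pi / 10 + φ : ℝ) * Complex.I)) := fun ρ φ => by
    rw [hζ]; push_cast; rw [add_mul, Complex.exp_add]; ring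
  have hζk' : ∀ (ρ φ : ℝ), ζ * (ρ * Complex.exp (φ * Complex.I))
      = rot (k + 1) * (ρ * Complex.exp ((-Real.pi / 10 + φ : ℝ) * Complex.I)) := fun ρ φ => by
    rw [hζk, rot_add, rot_one, ω]
    have : ((3 * Real.pi / 10 + φ : ℝ) : ℂ) * Complex.I
        = 2 * Real.pi * Complex.I / 5 + (-Real.pi / 10 + φ : ℝ) * Complex.I := by
      push_cast; ring
    rw [this, Complex.exp_add]; ring
  set f : ℂ → ℂ := fun z => ψ (ζ * z ^ (1 / 2 : ℂ)) with hf
  have hclosure : closure {z : ℂ | 0 < z.re} = {z | 0 ≤ z.re} := by simp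
  have hd : DiffContOnCl ℂ f {z | 0 < z.re} := by
    refine ⟨fun z hz => ?_, fun z hz => ?_⟩
    · have : DifferentiableAt ℂ (fun z : ℂ => z ^ (1 / 2 : ℂ)) z :=
        differentiableAt_id.cpow_const (Or.inl hz)
      exact ((h.isSolution.1 _).comp z (this.const_mul ζ)).differentiableWithinAt
    · rw [hclosure] at hz
      have := Complex.continuousAt_cpow_const_of_re_pos (z := z) (w := 1 / 2) (Or.inl hz) (by simp)
      exact (ContinuousAt.comp (g := ψ) (h.isSolution.1 _).continuousAt
        (this.const_mul ζ)).continuousWithinAt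
  have hre : Asymptotics.SuperpolynomialDecay atTop Real.exp fun x : ℝ => ‖f x‖ := by
    intro n
    obtain ⟨C, c, hc, R, hR, hdec⟩ := h'.exists_decay (θ := -Real.pi / 10)
      (by rw [abs_lt]; constructor <;> linarith)
    have hsq : Tendsto (fun x : ℝ => (Real.exp x ^ n * ‖f x‖) ^ 2) atTop (𝓝 0) := by
      have h0 := (tendsto_exp_pow_mul_decay n hc).const_mul C
      rw [mul_zero] at h0
      refine squeeze_zero' (Eventually.of_forall fun x => sq_nonneg _) ?_ h0
      filter_upwards [eventually_ge_atTop (R ^ 2)] with x hx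
      have hx0 : 0 ≤ x := (sq_nonneg R).trans hx
      have h1 := hdec (Real.sqrt x) (Real.le_sqrt_of_sq_le hx)
      have h2 := cpow_half_polar (φ := 0) hx0 (by linarith) hπ.le
      have h3 := hζk' (Real.sqrt x) 0
      simp only [Complex.ofReal_zero, zero_mul, Complex.exp_zero, mul_one, zero_div, add_zero]
        at h2 h3
      rw [mul_pow, hf]
      simp only [h2, h3]
      calc _ ≤ (Real.exp x ^ n) ^ 2 * (C * Real.exp (-(c * Real.sqrt (Real.sqrt x) ^ 5))) := by
            gcongr
        _ = _ := by ring
    have := hsq.sqrt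
    rw [Real.sqrt_zero] at this
    exact this.congr fun x => Real.sqrt_sq (by positivity)
  have him : ∃ C, ∀ x : ℝ, ‖f (x * Complex.I)‖ ≤ C := by
    obtain ⟨C₁, hC₁⟩ := h.exists_norm_le (θ := Real.pi / 20)
      (by rw [abs_lt]; constructor <;> linarith)
    obtain ⟨C₂, hC₂⟩ := h'.exists_norm_le (θ := 3 * Real.pi / 20)
      (by rw [abs_lt]; constructor <;> linarith)
    refine ⟨max C₁ C₂, fun x => ?_⟩
    rcases le_total 0 x with hx | hx
    · refine le_trans (le_of_eq ?_) ((hC₂ (Real.sqrt x) (Real.sqrt_nonneg x)).trans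
        (le_max_right _ _))
      have h1 : (x : ℂ) * Complex.I = x * Complex.exp ((Real.pi / 2 : ℝ) * Complex.I) := by
        push_cast; rw [Complex.exp_pi_div_two_mul_I]
      simp only [hf]
      rw [h1, cpow_half_polar hx (by linarith) (by linarith), hζk']
      congr 6
      push_cast; ring
    · refine le_trans (le_of_eq ?_) ((hC₁ (Real.sqrt (-x)) (Real.sqrt_nonneg _)).trans
        (le_max_left _ _))
      have h1 : (x : ℂ) * Complex.I
          = (-x : ℝ) * Complex.exp ((-(Real.pi / 2) : ℝ) * Complex.I) := by
        push_cast
        rw [neg_mul ((Real.pi : ℂ) / 2), Complex.exp_neg, Complex.exp_pi_div_two_mul_I,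
          Complex.inv_I]
        ring
      simp only [hf]
      rw [h1, cpow_half_polar (neg_nonneg.2 hx) (by linarith) (by linarith), hζk]
      congr 6
      push_cast; ring
  have hzero := PhragmenLindelof.eq_zero_on_right_half_plane_of_superexponential_decay hd
    (h.isSolution.isBigO_comp_cpow_half hζn _) hre him
  -- so `ψ` vanishes on a ray
  have hray : ∀ r : ℝ, 0 ≤ r → ψ (ζ * r) = 0 := fun r hr => by
    have h1 : f ((r ^ 2 : ℝ) : ℂ) = 0 := hzero <| by
      rw [Set.mem_ofPred_eq, Complex.ofReal_re]; positivity
    have h2 := cpow_half_polar (r := r ^ 2) (φ := 0) (by positivity) (by linarith) hπ.le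
    simp only [Complex.ofReal_zero, zero_mul, Complex.exp_zero, mul_one, zero_div,
      Real.sqrt_sq hr] at h2
    rw [hf] at h1
    simpa only [h2] using h1
  have hval : ψ ζ = 0 := by simpa using hray 1 zero_le_one
  have hder : deriv ψ ζ = 0 := by
    have hl : HasDerivAt (fun r : ℝ => ζ * (r : ℂ)) ζ 1 := by
      simpa using (Complex.ofRealCLM.hasDerivAt (x := 1)).const_mul ζ
    have h1 : HasDerivAt (fun r : ℝ => ψ (ζ * (r : ℂ))) (deriv ψ ζ * ζ) 1 :=
      (h.isSolution.hasDerivAt ζ).comp_of_eq (1 : ℝ) hl (by simp)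
    have h2 : (fun r : ℝ => ψ (ζ * (r : ℂ))) =ᶠ[𝓝 1] fun _ => 0 := by
      filter_upwards [lt_mem_nhds (zero_lt_one' ℝ)] with r hr using hray r hr.le
    have h3 := h1.unique ((hasDerivAt_const (1 : ℝ) (0 : ℂ)).congr_of_eventuallyEq h2)
    exact (mul_eq_zero.1 h3).resolve_right (norm_ne_zero_iff.1 (by rw [hζn]; exact one_ne_zero))
  obtain ⟨χ, hχ, hw⟩ := h.isSolution.exists_wr_ne_zero h.ne_zero
  apply hw
  rw [← wr_eq h.isSolution hχ ζ, hval, hder]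
  ring

theorem IsRecessive.wr_ne_zero {a b : ℂ} {k : ZMod 5} {φ ψ : ℂ → ℂ} (h : IsRecessive a b k ψ)
    (h' : IsRecessive a b (k + 1) φ) : wr ψ φ ≠ 0 := fun hw =>
  (h.of_wr_eq_zero h'.isSolution h'.ne_zero hw).not_isRecessive_add_one h'

/-! ### Brackets and cross ratios -/

theorem exists_homog_sphereQuot {u v : ℂ} (h : u ≠ 0 ∨ v ≠ 0) :
    ∃ c : ℂ, c ≠ 0 ∧ u = c * (homog (sphereQuot u v)).1 ∧ v = c * (homog (sphereQuot u v)).2 := by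
  by_cases hv : v = 0
  · exact ⟨u, h.resolve_right (not_not.2 hv), by simp [sphereQuot, homog, hv],
      by simp [sphereQuot, homog, hv]⟩
  · exact ⟨v, hv, by simp [sphereQuot, homog, hv, mul_div_cancel₀], by simp [sphereQuot, homog, hv]⟩

theorem bracket_self (z : OnePoint ℂ) : bracket z z = 0 := by
  unfold bracket; ring

theorem bracket_swap (z w : OnePoint ℂ) : bracket w z = -bracket z w := by
  unfold bracket; ring

theorem bracket_ne_zero {z w : OnePoint ℂ} (h : z ≠ w) : bracket z w ≠ 0 := by
  induction z using OnePoint.rec <;> induction w using OnePoint.rec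
  · exact absurd rfl h
  · simp [bracket, homog]
  · simp [bracket, homog]
  · rename_i x y
    have : x ≠ y := fun hxy => h (by rw [hxy])
    simpa [bracket, homog, sub_eq_zero] using this

/-- The Plücker relation. -/
theorem bracket_plucker (p q r s : OnePoint ℂ) :
    bracket p q * bracket r s - bracket p r * bracket q s + bracket p s * bracket q r = 0 := by
  unfold bracket; ring

/-- Sibuya's equation for five points with distinct neighbours: once the common brackets cancel, it
is the Plücker relation for `p₁, p₂, p₃, p₄`. -/
theorem crossRatio_mul_crossRatio {p₀ p₁ p₂ p₃ p₄ : OnePoint ℂ} (h₀₁ : p₀ ≠ p₁) (h₁₂ : p₁ ≠ p₂)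
    (h₃₄ : p₃ ≠ p₄) (h₄₀ : p₄ ≠ p₀) :
    crossRatio p₄ p₁ p₂ p₀ * crossRatio p₃ p₀ p₁ p₄ = 1 - crossRatio p₁ p₃ p₄ p₂ := by
  have h01 := bracket_ne_zero h₀₁
  have h12 := bracket_ne_zero h₁₂
  have h34 := bracket_ne_zero h₃₄
  have h40 := bracket_ne_zero h₄₀
  have hp := bracket_plucker p₁ p₂ p₃ p₄
  rw [crossRatio, crossRatio, crossRatio, bracket_swap p₀ p₁, bracket_swap p₄ p₀,
    bracket_swap p₂ p₄, bracket_swap p₁ p₃, bracket_swap p₂ p₃]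
  field_simp
  linear_combination -hp

theorem Rpoint_mul_Rpoint {z : ZMod 5 → OnePoint ℂ} (hz : z ∈ W5) (k : ZMod 5) :
    Rpoint (k - 2) z * Rpoint (k + 2) z = 1 - Rpoint k z := by
  have hb : ∀ m n : ZMod 5, m + 1 = n → z (m + k) ≠ z (n + k) := fun m n h => by
    rw [← h, add_right_comm]; exact hz _
  have e : ∀ i m j : ZMod 5, i + m = j → i + (k + m) = j + k := fun i m j h => by
    rw [← h]; ring
  have hc := crossRatio_mul_crossRatio (hb 0 1 rfl) (hb 1 2 rfl) (hb 3 4 rfl) (hb 4 0 rfl)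
  rw [Rpoint, Rpoint, Rpoint, sub_eq_add_neg k 2, e 1 (-2) 4 rfl, e (-2) (-2) 1 rfl,
    e (-1) (-2) 2 rfl, e 2 (-2) 0 rfl, e 1 2 3 rfl, e (-2) 2 0 rfl, e (-1) 2 1 rfl, e 2 2 4 rfl,
    show (-2 : ZMod 5) = 3 from rfl, show (-1 : ZMod 5) = 4 from rfl]
  exact hc

/-! ### The functions `R k` -/

/-- Asymptotic values, for the recessive solutions `ψ k`, in terms of the basis `φ, χ`. -/
noncomputable def asymptoticPoint (ψ : ZMod 5 → ℂ → ℂ) (φ χ : ℂ → ℂ) (k : ZMod 5) : OnePoint ℂ :=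
  sphereQuot (wr (ψ k) φ) (wr (ψ k) χ)

/-- Up to the choice of homogeneous coordinates, the brackets of the asymptotic values are the
Wronskians of the recessive solutions. -/
theorem exists_bracket_asymptoticPoint {a b : ℂ} {ψ : ZMod 5 → ℂ → ℂ}
    (hψ : ∀ k, IsRecessive a b k (ψ k)) {φ χ : ℂ → ℂ} (h : IsSolutionBasis a b φ χ) :
    ∃ c : ZMod 5 → ℂ, (∀ k, c k ≠ 0) ∧ ∀ i j, wr φ χ * wr (ψ i) (ψ j)
      = c i * c j * bracket (asymptoticPoint ψ φ χ i) (asymptoticPoint ψ φ χ j) := by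
  choose c hc h1 h2 using fun k => exists_homog_sphereQuot
    ((hψ k).isSolution.wr_ne_zero_or h (hψ k).ne_zero)
  refine ⟨c, hc, fun i j => ?_⟩
  have hpl : wr φ χ * wr (ψ i) (ψ j)
      = wr (ψ i) φ * wr (ψ j) χ - wr (ψ j) φ * wr (ψ i) χ := by unfold wr; ring
  have h1' : ∀ k, wr (ψ k) φ = c k * (homog (asymptoticPoint ψ φ χ k)).1 := h1
  have h2' : ∀ k, wr (ψ k) χ = c k * (homog (asymptoticPoint ψ φ χ k)).2 := h2
  generalize asymptoticPoint ψ φ χ = z at *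
  rw [hpl, h1' i, h2' i, h1' j, h2' j, bracket]
  ring

theorem asymptoticPoint_mem_W5 {a b : ℂ} {ψ : ZMod 5 → ℂ → ℂ}
    (hψ : ∀ k, IsRecessive a b k (ψ k)) {φ χ : ℂ → ℂ} (h : IsSolutionBasis a b φ χ) :
    asymptoticPoint ψ φ χ ∈ W5 := by
  intro k hk
  obtain ⟨c, -, hbr⟩ := exists_bracket_asymptoticPoint hψ h
  have := hbr k (k + 1)
  rw [hk, bracket_self, mul_zero] at this
  exact mul_ne_zero (isSolutionBasis_iff.1 h).2.2 ((hψ k).wr_ne_zero (hψ (k + 1))) this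

/-- The cross ratios of the asymptotic values are expressed by the Wronskians of the recessive
solutions; in particular they do not depend on the basis. -/
theorem Rpoint_asymptoticPoint {a b : ℂ} {ψ : ZMod 5 → ℂ → ℂ}
    (hψ : ∀ k, IsRecessive a b k (ψ k)) {φ χ : ℂ → ℂ} (h : IsSolutionBasis a b φ χ) (k : ZMod 5) :
    Rpoint k (asymptoticPoint ψ φ χ)
      = (wr (ψ (1 + k)) (ψ (-1 + k)) * wr (ψ (-2 + k)) (ψ (2 + k))) /
        (wr (ψ (1 + k)) (ψ (2 + k)) * wr (ψ (-2 + k)) (ψ (-1 + k))) := by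
  obtain ⟨c, hc, hbr⟩ := exists_bracket_asymptoticPoint hψ h
  have hw := (isSolutionBasis_iff.1 h).2.2
  have hbr' : ∀ i j, wr (ψ i) (ψ j)
      = c i * c j / wr φ χ * bracket (asymptoticPoint ψ φ χ i) (asymptoticPoint ψ φ χ j) :=
    fun i j => by
      rw [div_mul_eq_mul_div, ← hbr i j, mul_div_cancel_left₀ _ hw]
  have hne : c (1 + k) * c (-2 + k) * c (-1 + k) * c (2 + k) / wr φ χ ^ 2 ≠ 0 :=
    div_ne_zero (mul_ne_zero (mul_ne_zero (mul_ne_zero (hc _) (hc _)) (hc _)) (hc _))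
      (pow_ne_zero 2 hw)
  rw [Rpoint, crossRatio, hbr', hbr', hbr', hbr']
  set z := asymptoticPoint ψ φ χ
  rw [← mul_div_mul_left (bracket (z (1 + k)) (z (-1 + k)) * bracket (z (-2 + k)) (z (2 + k)))
    (bracket (z (1 + k)) (z (2 + k)) * bracket (z (-2 + k)) (z (-1 + k))) hne]
  congr 1 <;> ring

theorem exists_asymptotic_values {a b : ℂ} {φ χ : ℂ → ℂ} (h : IsSolutionBasis a b φ χ) :
    ∃ z ∈ W5, (∀ k, IsAsymptoticValue φ χ k (z k)) ∧ ∀ k, R k a b = Rpoint k z := by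
  choose ψ hψ using exists_isRecessive a b
  have hz : ∀ {φ χ : ℂ → ℂ}, IsSolutionBasis a b φ χ →
      ∀ k, IsAsymptoticValue φ χ k (asymptoticPoint ψ φ χ k) :=
    fun hb k => (hψ k).isAsymptoticValue hb
  refine ⟨_, asymptoticPoint_mem_W5 hψ h, hz h, fun k => ?_⟩
  have hmono : ∃ z, IsMonodromyPoint a b z := ⟨_, φ, χ, h, hz h⟩
  obtain ⟨φ', χ', h', hm⟩ : IsMonodromyPoint a b (monodromyPoint a b) :=
    Classical.epsilon_spec hmono
  have : monodromyPoint a b = asymptoticPoint ψ φ' χ' :=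
    funext fun j => (hm j).unique (hz h' j)
  rw [R, this, Rpoint_asymptoticPoint hψ h', Rpoint_asymptoticPoint hψ h]

/-- If `φ, χ` is a basis for the parameters `a, b`, then `x ↦ φ (ω ^ 3 x), χ (ω ^ 3 x)` is one for
`ω⁻¹ a, ω b`, and its asymptotic values are the shifted ones. -/
theorem R_rotationSymmetric : RotationSymmetric R := by
  intro k a b
  obtain ⟨φ, χ, h⟩ := exists_isSolutionBasis a b
  obtain ⟨z, -, hz, hR⟩ := exists_asymptotic_values h
  have h3 := h.comp_rot 3
  have hrot : rot 3 = ω ^ 3 := rot_natCast 3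
  have ha : rot 3 ^ 3 = ω⁻¹ := by
    rw [hrot]
    exact eq_inv_of_mul_eq_one_left (by linear_combination (ω ^ 5 + 1) * ω_pow_five)
  have hb : rot 3 ^ 2 = ω := by
    rw [hrot]; linear_combination ω * ω_pow_five
  rw [ha, hb] at h3
  obtain ⟨z', -, hz', hR'⟩ := exists_asymptotic_values h3
  have hzz : ∀ j, z' j = z (3 + j) := fun j => (hz' j).unique (hz (3 + j)).comp_rot
  rw [hR', hR, Rpoint, Rpoint, hzz, hzz, hzz, hzz]
  have e : ∀ i : ZMod 5, 3 + (i + k) = i + (k - 2) := fun i => by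
    rw [show (3 : ZMod 5) = -2 from rfl]; ring
  rw [e, e, e, e]

theorem R_sibuyaEq (k : ZMod 5) (a b : ℂ) : SibuyaEq R k a b := by
  have h1 := R_rotationSymmetric k a b
  have h2 := R_rotationSymmetric (k + 2) (ω * a) (ω⁻¹ * b)
  rw [inv_mul_cancel_left₀ ω_ne_zero, mul_inv_cancel_left₀ ω_ne_zero, add_sub_cancel_right] at h2
  obtain ⟨φ, χ, h⟩ := exists_isSolutionBasis a b
  obtain ⟨z, hz5, -, hR⟩ := exists_asymptotic_values h
  rw [SibuyaEq, h1, ← h2, hR, hR, hR]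
  exact Rpoint_mul_Rpoint hz5 k

/-! ### The deformed Y-system -/

/-- The Y-system consists of Sibuya's equations for `F 0` at the parameters `ω ^ (-k) a, b`, where
`b = exp (6 θ / 5)` is rotated by `ω ^ (± 1)` when `θ` is shifted by `± π i / 3`. -/
theorem deformedYSystem_iff_sibuyaEq_zero (F : ZMod 5 → ℂ → ℂ → ℂ) (a : ℂ) :
    DeformedYSystem F a ↔ ∀ (k : ZMod 5) (b : ℂ), b ≠ 0 → SibuyaEq F 0 ((rot k)⁻¹ * a) b := by
  have key : ∀ (k : ZMod 5) (θ : ℂ), (Y F a (k - 1) (θ - Complex.I * Real.pi / 3) *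
      Y F a (k + 1) (θ + Complex.I * Real.pi / 3) = 1 + Y F a k θ) ↔
      SibuyaEq F 0 ((rot k)⁻¹ * a) (Complex.exp (6 / 5 * θ)) := fun k θ => by
    have h1 : (rot (k - 1))⁻¹ * a = ω * ((rot k)⁻¹ * a) := by
      rw [sub_eq_add_neg, rot_add, rot_neg, rot_one, mul_inv, inv_inv]; ring
    have h2 : (rot (k + 1))⁻¹ * a = ω⁻¹ * ((rot k)⁻¹ * a) := by
      rw [rot_add, rot_one, mul_inv]; ring
    have h3 : Complex.exp (6 / 5 * (θ - Complex.I * Real.pi / 3))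
        = ω⁻¹ * Complex.exp (6 / 5 * θ) := by
      rw [ω, ← Complex.exp_neg, ← Complex.exp_add]; ring_nf
    have h4 : Complex.exp (6 / 5 * (θ + Complex.I * Real.pi / 3))
        = ω * Complex.exp (6 / 5 * θ) := by
      rw [ω, ← Complex.exp_add]; ring_nf
    change -F 0 ((rot (k - 1))⁻¹ * a) _ * -F 0 ((rot (k + 1))⁻¹ * a) _
      = 1 + -F 0 ((rot k)⁻¹ * a) _ ↔ _
    rw [h1, h2, h3, h4, SibuyaEq, neg_mul_neg, mul_comm, ← sub_eq_add_neg]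
  refine forall_congr' fun k => ⟨fun h b hb => ?_,
    fun h θ => (key k θ).2 (h _ (Complex.exp_ne_zero _))⟩
  have := (key k (5 / 6 * Complex.log b)).1 (h _)
  rwa [← mul_assoc, show (6 / 5 * (5 / 6) : ℂ) = 1 by norm_num, one_mul,
    Complex.exp_log hb] at this

theorem RotationSymmetric.sibuyaEq_iff {F : ZMod 5 → ℂ → ℂ → ℂ} (hF : RotationSymmetric F)
    (k : ZMod 5) (a b : ℂ) : SibuyaEq F k (ω⁻¹ * a) (ω * b) ↔ SibuyaEq F (k - 2) a b := by
  have h : ω * (ω⁻¹ * a) = ω⁻¹ * (ω * a) := mul_left_comm _ _ _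
  have h' : ω⁻¹ * (ω * b) = ω * (ω⁻¹ * b) := mul_left_comm _ _ _
  rw [SibuyaEq, SibuyaEq, h, h', hF k (ω⁻¹ * a), hF k (ω * a), hF k a]

theorem RotationSymmetric.sibuyaEq_pow_iff {F : ZMod 5 → ℂ → ℂ → ℂ} (hF : RotationSymmetric F)
    (n : ℕ) (k : ZMod 5) (a b : ℂ) :
    SibuyaEq F k ((ω ^ n)⁻¹ * a) (ω ^ n * b) ↔ SibuyaEq F (k - 2 * n) a b := by
  induction n generalizing k with
  | zero => simp
  | succ n ih =>
    rw [pow_succ', mul_inv, mul_assoc, mul_assoc, hF.sibuyaEq_iff, ih]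
    push_cast
    rw [show k - 2 - 2 * (n : ZMod 5) = k - 2 * (n + 1) by ring]

theorem RotationSymmetric.sibuyaEq_rot_iff {F : ZMod 5 → ℂ → ℂ → ℂ} (hF : RotationSymmetric F)
    (k : ZMod 5) (a b : ℂ) :
    SibuyaEq F 0 ((rot k)⁻¹ * a) b ↔ SibuyaEq F (-2 * k) a ((rot k)⁻¹ * b) := by
  have := hF.sibuyaEq_pow_iff k.val 0 a ((rot k)⁻¹ * b)
  rw [← rot, mul_inv_cancel_left₀ (rot_ne_zero k), ZMod.natCast_zmod_val] at this
  rw [this, zero_sub, neg_mul]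

theorem RotationSymmetric.sibuyaEq_iff_deformedYSystem {F : ZMod 5 → ℂ → ℂ → ℂ}
    (hF : RotationSymmetric F) (a : ℂ) :
    (∀ (k : ZMod 5) (b : ℂ), b ≠ 0 → SibuyaEq F k a b) ↔ DeformedYSystem F a := by
  rw [deformedYSystem_iff_sibuyaEq_zero]
  constructor
  · intro h k b hb
    exact (hF.sibuyaEq_rot_iff k a b).2 (h _ _ (mul_ne_zero (inv_ne_zero (rot_ne_zero k)) hb))
  · intro h k b hb
    -- `2` is the inverse of `-2` modulo `5`
    have := (hF.sibuyaEq_rot_iff (2 * k) a (rot (2 * k) * b)).1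
      (h _ _ (mul_ne_zero (rot_ne_zero _) hb))
    rwa [inv_mul_cancel_left₀ (rot_ne_zero _), ← mul_assoc, show (-2 * 2 : ZMod 5) = 1 from rfl,
      one_mul] at this

/-- Both sides of Sibuya's equation are continuous at `b = 0`. -/
theorem sibuyaEq_zero_of_continuousAt {F : ZMod 5 → ℂ → ℂ → ℂ} {k : ZMod 5} {a : ℂ}
    (hc : ∀ c, ContinuousAt (F k c) 0) (h : ∀ b, b ≠ 0 → SibuyaEq F k a b) :
    SibuyaEq F k a 0 := by
  have hmul : ∀ c ζ : ℂ, ContinuousAt (fun b => F k c (ζ * b)) 0 := fun c ζ =>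
    ContinuousAt.comp_of_eq (hc c) (by fun_prop) (by simp)
  have hl := ((hmul (ω⁻¹ * a) ω).mul (hmul (ω * a) ω⁻¹)).continuousWithinAt (s := {0}ᶜ)
  have hr := ((continuousAt_const (y := (1 : ℂ))).sub (hc a)).continuousWithinAt (s := {0}ᶜ)
  exact tendsto_nhds_unique hl.tendsto (hr.tendsto.congr' (by
    filter_upwards [self_mem_nhdsWithin] with b hb using (h b hb).symm))

end CubicOscillator

theorem mainTheorem2 :
    -- `R` is well defined: for every basis of solutions the five asymptotic values exist, form a
    -- point of `W5`, and give the same values of the functions `R_k`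
    (∀ a b : ℂ, (∃ φ χ : ℂ → ℂ, CubicOscillator.IsSolutionBasis a b φ χ) ∧
      ∀ φ χ : ℂ → ℂ, CubicOscillator.IsSolutionBasis a b φ χ →
        ∃ z ∈ CubicOscillator.W5,
          (∀ k, CubicOscillator.IsAsymptoticValue φ χ k (z k)) ∧
          ∀ k, CubicOscillator.R k a b = CubicOscillator.Rpoint k z) ∧
    -- the symmetry
    (∀ (k : ZMod 5) (a b : ℂ),
      CubicOscillator.R k (CubicOscillator.ω⁻¹ * a) (CubicOscillator.ω * b)
        = CubicOscillator.R (k - 2) a b) ∧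
    -- Sibuya's equation
    (∀ (k : ZMod 5) (a b : ℂ), CubicOscillator.SibuyaEq CubicOscillator.R k a b) ∧
    -- the deformed Y-system
    (∀ a : ℂ, CubicOscillator.DeformedYSystem CubicOscillator.R a) ∧
    -- the equivalence of the last two, for every family with the symmetry
    (∀ F : ZMod 5 → ℂ → ℂ → ℂ, CubicOscillator.RotationSymmetric F → ∀ a : ℂ,
      ((∀ (k : ZMod 5) (b : ℂ), b ≠ 0 → CubicOscillator.SibuyaEq F k a b) ↔
        CubicOscillator.DeformedYSystem F a) ∧
      ((∀ (k : ZMod 5) (c : ℂ), ContinuousAt (F k c) 0) →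
        ((∀ (k : ZMod 5) (b : ℂ), CubicOscillator.SibuyaEq F k a b) ↔
          CubicOscillator.DeformedYSystem F a))) := by
  refine ⟨fun a b => ⟨CubicOscillator.exists_isSolutionBasis a b,
      fun φ χ h => CubicOscillator.exists_asymptotic_values h⟩,
    CubicOscillator.R_rotationSymmetric, CubicOscillator.R_sibuyaEq,
    fun a => (CubicOscillator.R_rotationSymmetric.sibuyaEq_iff_deformedYSystem a).1
      fun k b _ => CubicOscillator.R_sibuyaEq k a b,
    fun F hF a => ⟨hF.sibuyaEq_iff_deformedYSystem a, fun hc => ?_⟩⟩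
  rw [← hF.sibuyaEq_iff_deformedYSystem a]
  refine ⟨fun h k b _ => h k b, fun h k b => ?_⟩
  rcases eq_or_ne b 0 with rfl | hb
  · exact CubicOscillator.sibuyaEq_zero_of_continuousAt (hc k) (h k)
  · exact h k b hb
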